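/- Consider the one-dimensional long-range ferromagnetic Ising model on $\{-1,+1\}^{\mathbb Z}$ with coupling $J(r)=r^{-\alpha}$ for $r\ge 1$ (so $J(1)=1$) and $J(0)=0$, and Hamiltonian $$H_J(\sigma)=\sum_{x<y}J(|x-y|)\,(1-\sigma_x\sigma_y)$$ for configurations $\sigma$ that are constant outside a finite set. For $\beta>0$, $L\in\mathbb N$ and a sign $\pm$, let $\langle\cdot\rangle^{\pm}_{\alpha,\beta,L}$ be the probability measure on the configurations equal to $\pm1$ outside $[-L,L]$ whose weights are proportional to $e^{-\beta H_J(\sigma)}$, and let $\langle\cdot\rangle^{\pm}_{\alpha,\beta}$ denote its weak limit as $L\to\infty$. **Theorem.** Let $1<\alpha\le 2$. There exists $\bar\beta=\bar\beta(\alpha)>0$ such that for every $\beta\ge\bar\beta$ the limits $\langle\cdot\rangle^{-}_{\alpha,\beta}$ and $\langle\cdot\rangle^{+}_{\alpha,\beta}$ exist, are infinite-volume Gibbs measures (that is, satisfy the DLR equations) for $J$ at inverse temperature $\beta$, and satisfy $$\langle\sigma_0\rangle^-_{\alpha,\beta}\neq\langle\sigma_0\rangle^+_{\alpha,\beta}.$$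 In particular there is a phase transition: there are at least two distinct Gibbs measures. -/

import Mathlib

open MeasureTheory Filter Topology

noncomputable section

namespace LongRangeIsing

/-- Spin configurations `σ : ℤ → {-1, +1}`; the units of `ℤ` are exactly `1` and `-1`.
The topology and the σ-algebra are the product ones. -/
abbrev Config : Type := ℤ → ℤˣ

instance : MeasurableSingletonClass ℤˣ where
  measurableSet_singleton u := by
    have h : ({u} : Set ℤˣ) = (fun v : ℤˣ => (v : ℤ)) ⁻¹' {(u : ℤ)} := by
      ext v; simp [Units.ext_iff]
    rw [h]
    exact ⟨_, MeasurableSet.of_discrete, rfl⟩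

/-- The spin `σ_x` at the site `x`, as a real number. -/
def spin (σ : Config) (x : ℤ) : ℝ := ((σ x : ℤ) : ℝ)

/-- The coupling `J(0) = 0`, `J(r) = r^{-α}` for `r ≥ 1`. -/
def coupling (α : ℝ) (r : ℕ) : ℝ := if r = 0 then 0 else (r : ℝ) ^ (-α)

/-- The contribution `J(|x - y|) (1 - σ_x σ_y)` of the pair `p = (x, y)` to the energy. -/
def pairEnergy (α : ℝ) (σ : Config) (p : ℤ × ℤ) : ℝ :=
  coupling α (p.1 - p.2).natAbs * (1 - spin σ p.1 * spin σ p.2)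

/-- The Hamiltonian `H_J(σ) = ∑_{x < y} J(|x - y|) (1 - σ_x σ_y)`. It is used only for
configurations that are constant outside a finite set, for which the series converges
(when `α > 1`). -/
def energy (α : ℝ) (σ : Config) : ℝ :=
  ∑' p : ℤ × ℤ, if p.1 < p.2 then pairEnergy α σ p else 0

/-- The energy in a finite volume `Λ` of an arbitrary configuration: the sum of
`J(|x - y|) (1 - σ_x σ_y)` over the pairs `x < y` with at least one site in `Λ`. -/
def energyIn (α : ℝ) (Λ : Finset ℤ) (σ : Config) : ℝ :=
  ∑' p : ℤ × ℤ, if p.1 < p.2 ∧ (p.1 ∈ Λ ∨ p.2 ∈ Λ) then pairEnergy α σ p else 0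

/-- The configuration equal to `τ` in `Λ` and to `η` outside. -/
def glue (Λ : Finset ℤ) (η : Config) (τ : Λ → ℤˣ) : Config :=
  fun x => if h : x ∈ Λ then τ ⟨x, h⟩ else η x

/-- The partition function in `Λ` with boundary condition `η`, for the energy `E`. -/
def partitionFn (E : Config → ℝ) (β : ℝ) (Λ : Finset ℤ) (η : Config) : ℝ :=
  ∑ τ : Λ → ℤˣ, Real.exp (-β * E (glue Λ η τ))

/-- The probability measure on configurations equal to `η` outside `Λ` that gives to each of
them a weight proportional to `exp (-β E)`. -/
def gibbsIn (E : Config → ℝ) (β : ℝ) (Λ : Finset ℤ) (η : Config) : Measure Config :=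
  ∑ τ : Λ → ℤˣ, ENNReal.ofReal (Real.exp (-β * E (glue Λ η τ)) / partitionFn E β Λ η) •
    Measure.dirac (glue Λ η τ)

theorem partitionFn_pos (E : Config → ℝ) (β : ℝ) (Λ : Finset ℤ) (η : Config) :
    0 < partitionFn E β Λ η :=
  Finset.sum_pos (fun _ _ => Real.exp_pos _) Finset.univ_nonempty

instance (E : Config → ℝ) (β : ℝ) (Λ : Finset ℤ) (η : Config) :
    IsProbabilityMeasure (gibbsIn E β Λ η) := by
  constructor
  have hZ := partitionFn_pos E β Λ η
  simp only [gibbsIn, Measure.coe_finsetSum, Finset.sum_apply, Measure.smul_apply,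
    measure_univ, smul_eq_mul, mul_one]
  rw [← ENNReal.ofReal_sum_of_nonneg fun _ _ => (div_pos (Real.exp_pos _) hZ).le,
    ← Finset.sum_div]
  change ENNReal.ofReal (partitionFn E β Λ η / partitionFn E β Λ η) = 1
  rw [div_self hZ.ne', ENNReal.ofReal_one]

/-- The finite-volume Gibbs measure in the box `[-L, L]`, at inverse temperature `β`, with
all spins outside the box equal to `s`. -/
def boxMeasure (s : ℤˣ) (α β : ℝ) (L : ℕ) : ProbabilityMeasure Config :=
  ⟨gibbsIn (energy α) β (Finset.Icc (-(L : ℤ)) L) (fun _ => s), inferInstance⟩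

/-- Infinite-volume Gibbs measures, in the sense of Dobrushin, Lanford and Ruelle: `μ` is
invariant under resampling the spins in any finite set `Λ` given those outside `Λ`. -/
def IsGibbsMeasure (α β : ℝ) (μ : ProbabilityMeasure Config) : Prop :=
  ∀ (Λ : Finset ℤ) (A : Set Config), MeasurableSet A →
    (μ : Measure Config) A = ∫⁻ η, gibbsIn (energyIn α Λ) β Λ η A ∂(μ : Measure Config)

/-- For a constant boundary condition the two energies agree. -/
theorem energyIn_glue_const (α : ℝ) (Λ : Finset ℤ) (s : ℤˣ) (τ : Λ → ℤˣ) :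
    energyIn α Λ (glue Λ (fun _ => s) τ) = energy α (glue Λ (fun _ => s) τ) := by
  refine tsum_congr fun p => ?_
  by_cases h : p.1 ∈ Λ ∨ p.2 ∈ Λ
  · simp [h]
  · have hs : ((s : ℤ) : ℝ) * ((s : ℤ) : ℝ) = 1 := by
      rcases Int.units_eq_one_or s with rfl | rfl <;> simp
    have h1 : p.1 ∉ Λ := fun h' => h (Or.inl h')
    have h2 : p.2 ∉ Λ := fun h' => h (Or.inr h')
    simp [h1, h2, pairEnergy, spin, glue, hs]

end LongRangeIsing

end

/-! By spin-flip symmetry it is enough to bound the `+` magnetization at the origin below, uniformly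
in the volume. The bound comes from comparing the Ising model with independent long-range
percolation.

With `+` boundary condition every spin product is a sign character of the finite group {±1}^Λ.
Ginibre's duplication argument then gives the Griffiths inequalities (`Ferro.gks`). They make a
correlation increasing and concave in the strength tanh K of each interaction. Hence it dominates a
mixture of "interaction removed" and "spins locked together", with locking probability 1 - exp(-K).
Doing this edge by edge (`Ferro.prob_le_avg_exp_sum`) bounds the magnetization below by the
probability that open edges lock the origin to a site outside Λ, where the spin is `+`.

Since α ≤ 2, the couplings dominate r^(-2). Percolation with edge probabilities 1 - exp(-b/r²) and b
= 432 is treated by renormalization (`FailBound.step`). A large block can lack a dense cluster only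
if two disjoint sub-blocks are bad, which costs ε², or if dense clusters on the two sides of one
sub-block are not joined. The interaction across such a gap is scale invariant and grows like the
logarithm of the number of sub-blocks, so the second event has a probability that is a power with
exponent proportional to b. Iterating (`exists_failBound`) gives clusters of any size containing the
origin with probability at least 1/4. A cluster with more sites than Λ must leave Λ.

The `+` limit exists because its correlations decrease with the volume. It satisfies DLR because
finite-volume measures are consistent and the resampling kernels preserve continuity; the `-` state
is its image under the flip. -/

open MeasureTheory Filter Topology

noncomputable section

namespace LongRangeIsing

/-! ### Griffiths inequalities on finite groups of spins, by duplication. -/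

section GKS

variable {G : Type*}

/-- The expectation of `f` for the probability weights proportional to `W`. -/
def avg [Fintype G] (W f : G → ℝ) : ℝ := (∑ g, f g * W g) / ∑ g, W g

theorem avg_congr_mul [Fintype G] {W W' : G → ℝ} {c : ℝ} (hc : c ≠ 0)
    (h : ∀ g, W' g = c * W g) (f : G → ℝ) : avg W' f = avg W f := by
  have h1 : ∑ g, f g * W' g = c * ∑ g, f g * W g := by
    rw [Finset.mul_sum]; exact Finset.sum_congr rfl fun g _ => by rw [h]; ring
  have h2 : ∑ g, W' g = c * ∑ g, W g := by
    rw [Finset.mul_sum]; exact Finset.sum_congr rfl fun g _ => h g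
  rw [avg, avg, h1, h2, mul_div_mul_left _ _ hc]

variable [CommGroup G]

/-- A sign character of `G`, as a real-valued function. -/
def chr (χ : G →* ℤˣ) (g : G) : ℝ := ((χ g : ℤ) : ℝ)

theorem chr_eq_one_or (χ : G →* ℤˣ) (g : G) : chr χ g = 1 ∨ chr χ g = -1 := by
  rcases Int.units_eq_one_or (χ g) with h | h <;> simp [chr, h]

theorem chr_mul_self (χ : G →* ℤˣ) (g : G) : chr χ g * chr χ g = 1 := by
  rcases chr_eq_one_or χ g with h | h <;> simp [h]

theorem chr_le_one (χ : G →* ℤˣ) (g : G) : chr χ g ≤ 1 := by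
  rcases chr_eq_one_or χ g with h | h <;> simp [h]

@[simp] theorem chr_map_one (χ : G →* ℤˣ) : chr χ 1 = 1 := by simp [chr]

theorem chr_mul (χ ψ : G →* ℤˣ) (g : G) : chr (χ * ψ) g = chr χ g * chr ψ g := by
  simp [chr]

theorem chr_map_mul (χ : G →* ℤˣ) (g h : G) : chr χ (g * h) = chr χ g * chr χ h := by
  simp [chr]

variable [Fintype G]

/-- Translation by an element where χ = -1 reverses the sign of the sum, so the sum of a nontrivial
character is zero. -/
theorem sum_chr_nonneg (χ : G →* ℤˣ) : 0 ≤ ∑ g, chr χ g := by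
  by_cases h : ∀ g, chr χ g = 1
  · simp [h]
  · push Not at h
    obtain ⟨g₀, hg₀⟩ := h
    have h1 : chr χ g₀ = -1 := (chr_eq_one_or χ g₀).resolve_left hg₀
    have h2 : ∑ g, chr χ g = ∑ g, chr χ (g₀ * g) :=
      (Fintype.sum_equiv (Equiv.mulLeft g₀) _ _ fun _ => rfl).symm
    simp only [chr_map_mul, h1, neg_one_mul, Finset.sum_neg_distrib] at h2
    linarith

/-- Ferromagnetic weights: those whose duplicated version has nonnegative Fourier
coefficients. -/
structure Ferro (W : G → ℝ) : Prop where
  nonneg : ∀ g, 0 ≤ W g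
  one_pos : 0 < W 1
  dup : ∀ (ρ : G) (χ : G →* ℤˣ), 0 ≤ ∑ g, chr χ g * (W g * W (g * ρ))

theorem Ferro.sum_pos {W : G → ℝ} (hW : Ferro W) : 0 < ∑ g, W g :=
  Finset.sum_pos' (fun g _ => hW.nonneg g) ⟨1, Finset.mem_univ _, hW.one_pos⟩

theorem ferro_one : Ferro (fun _ : G => (1 : ℝ)) where
  nonneg _ := zero_le_one
  one_pos := one_pos
  dup ρ χ := by simpa using sum_chr_nonneg χ

/-- Since ψ² = 1, the duplicated factor (a + bψ(g))(a + bψ(gρ)) equals (a² + b²ψ(ρ)) + ab(1 +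
ψ(ρ))ψ(g). Both coefficients are nonnegative when b ≤ a, and the extra ψ(g) only shifts the Fourier
index. -/
theorem Ferro.mul_affine {W : G → ℝ} (hW : Ferro W) (ψ : G →* ℤˣ) {a b : ℝ} (ha : 0 < a)
    (hb : 0 ≤ b) (hba : b ≤ a) : Ferro fun g => W g * (a + b * chr ψ g) where
  nonneg g := by
    refine mul_nonneg (hW.nonneg g) ?_
    rcases chr_eq_one_or ψ g with h | h <;> rw [h] <;> linarith
  one_pos := by
    have := hW.one_pos
    rw [chr_map_one]; positivity
  dup ρ χ := by
    have h1 := hW.dup ρ χ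
    have h2 := hW.dup ρ (χ * ψ)
    have key : ∑ g, chr χ g * (W g * (a + b * chr ψ g) * (W (g * ρ) * (a + b * chr ψ (g * ρ))))
        = (a ^ 2 + b ^ 2 * chr ψ ρ) * ∑ g, chr χ g * (W g * W (g * ρ)) +
          a * b * (1 + chr ψ ρ) * ∑ g, chr (χ * ψ) g * (W g * W (g * ρ)) := by
      rw [Finset.mul_sum, Finset.mul_sum, ← Finset.sum_add_distrib]
      refine Finset.sum_congr rfl fun g _ => ?_
      rw [chr_mul, chr_map_mul]
      have := chr_mul_self ψ g
      linear_combination (chr χ g * W g * W (g * ρ) * b ^ 2 * chr ψ ρ) * this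
    rw [key]
    rcases chr_eq_one_or ψ ρ with h | h <;> rw [h]
    · positivity
    · have : 0 ≤ a ^ 2 + b ^ 2 * (-1) := by nlinarith
      simpa using mul_nonneg this h1

/-- For s = ±1, exp(-K(1 - s)) = exp(-K)(cosh K + s sinh K), which is an admissible affine factor.
-/
theorem Ferro.mul_exp {W : G → ℝ} (hW : Ferro W) (ψ : G →* ℤˣ) {K : ℝ} (hK : 0 ≤ K) :
    Ferro fun g => W g * Real.exp (-(K * (1 - chr ψ g))) := by
  have h := hW.mul_affine ψ (a := Real.exp (-K) * Real.cosh K) (b := Real.exp (-K) * Real.sinh K)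
    (by positivity) (mul_nonneg (Real.exp_pos _).le (Real.sinh_nonneg_iff.2 hK))
    (mul_le_mul_of_nonneg_left (Real.sinh_lt_cosh K).le (Real.exp_pos _).le)
  convert h using 2 with g
  congr 1
  rcases chr_eq_one_or ψ g with h | h <;> rw [h]
  · rw [mul_one, ← mul_add, Real.cosh_add_sinh, ← Real.exp_add]; simp
  · rw [mul_neg_one, ← sub_eq_add_neg, ← mul_sub, Real.cosh_sub_sinh, ← Real.exp_add]
    congr 1; ring

theorem Ferro.of_tendsto {ι : Type*} {l : Filter ι} [l.NeBot] {F : ι → G → ℝ} {W : G → ℝ}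
    (hF : ∀ i, Ferro (F i)) (hlim : ∀ g, Tendsto (fun i => F i g) l (𝓝 (W g)))
    (h1 : 0 < W 1) : Ferro W where
  nonneg g := ge_of_tendsto' (hlim g) fun i => (hF i).nonneg g
  one_pos := h1
  dup ρ χ := by
    have h : Tendsto (fun i => ∑ g, chr χ g * (F i g * F i (g * ρ))) l
        (𝓝 (∑ g, chr χ g * (W g * W (g * ρ)))) :=
      tendsto_finsetSum _ fun g _ => ((hlim g).mul (hlim (g * ρ))).const_mul (chr χ g)
    exact ge_of_tendsto' h fun i => (hF i).dup ρ χ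

theorem Ferro.mul_exp_sum {ι : Type*} {W : G → ℝ} (hW : Ferro W) (S : Finset ι) (K : ι → ℝ)
    (hK : ∀ i, 0 ≤ K i) (ψ : ι → G →* ℤˣ) :
    Ferro fun g => W g * Real.exp (-∑ i ∈ S, K i * (1 - chr (ψ i) g)) := by
  classical
  induction S using Finset.induction_on with
  | empty => simpa using hW
  | insert i S hi ih =>
    convert ih.mul_exp (ψ i) (hK i) using 2 with g
    rw [Finset.sum_insert hi, mul_assoc, ← Real.exp_add, neg_add_rev]

theorem ferro_exp_tsum {ι : Type*} (K : ι → ℝ) (hK : ∀ i, 0 ≤ K i) (ψ : ι → G →* ℤˣ)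
    (hs : ∀ g, Summable fun i => K i * (1 - chr (ψ i) g)) :
    Ferro fun g => Real.exp (-∑' i, K i * (1 - chr (ψ i) g)) := by
  refine Ferro.of_tendsto (l := atTop)
    (F := fun (S : Finset ι) g => 1 * Real.exp (-∑ i ∈ S, K i * (1 - chr (ψ i) g)))
    (fun S => ferro_one.mul_exp_sum S K hK ψ) (fun g => ?_) (Real.exp_pos _)
  simp only [one_mul]
  have h : Tendsto (fun S : Finset ι => ∑ i ∈ S, K i * (1 - chr (ψ i) g)) atTop
    (𝓝 (∑' i, K i * (1 - chr (ψ i) g))) := (hs g).hasSum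
  exact (Real.continuous_exp.tendsto _).comp h.neg

/-- The second Griffiths inequality, without denominators. -/
theorem Ferro.gks {W : G → ℝ} (hW : Ferro W) (χ ψ : G →* ℤˣ) :
    (∑ g, chr χ g * W g) * (∑ g, chr ψ g * W g) ≤
      (∑ g, chr χ g * chr ψ g * W g) * ∑ g, W g := by
  -- Writing the second copy of g as gρ gives ψ(gρ) = ψ(g)ψ(ρ), so the difference has the
  -- nonnegative weights 1 - ψ(ρ) in front of the duplicated Fourier coefficients.
  have key : (∑ g, chr χ g * chr ψ g * W g) * (∑ g, W g) -
      (∑ g, chr χ g * W g) * (∑ g, chr ψ g * W g) =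
      ∑ ρ, (1 - chr ψ ρ) * ∑ g, chr (χ * ψ) g * (W g * W (g * ρ)) := by
    have hsh : ∀ (F : G → ℝ) (g : G), ∑ h, F h = ∑ ρ, F (g * ρ) := fun F g =>
      (Fintype.sum_equiv (Equiv.mulLeft g) _ _ fun _ => rfl).symm
    have e1 : (∑ g, chr χ g * chr ψ g * W g) * (∑ g, W g) =
        ∑ g, ∑ ρ, chr χ g * chr ψ g * W g * W (g * ρ) := by
      rw [Finset.sum_mul]
      refine Finset.sum_congr rfl fun g _ => ?_
      rw [hsh W g, Finset.mul_sum]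
    have e2 : (∑ g, chr χ g * W g) * (∑ g, chr ψ g * W g) =
        ∑ g, ∑ ρ, chr χ g * W g * (chr ψ (g * ρ) * W (g * ρ)) := by
      rw [Finset.sum_mul]
      refine Finset.sum_congr rfl fun g _ => ?_
      rw [hsh (fun h => chr ψ h * W h) g, Finset.mul_sum]
    rw [e1, e2, ← Finset.sum_sub_distrib]
    simp_rw [← Finset.sum_sub_distrib]
    rw [Finset.sum_comm]
    refine Finset.sum_congr rfl fun ρ _ => ?_
    rw [Finset.mul_sum]
    refine Finset.sum_congr rfl fun g _ => ?_
    rw [chr_mul, chr_map_mul]; ring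
  rw [← sub_nonneg, key]
  exact Finset.sum_nonneg fun ρ _ =>
    mul_nonneg (by linarith [chr_le_one ψ ρ]) (hW.dup ρ _)

theorem Ferro.sum_chr_mul_nonneg {W : G → ℝ} (hW : Ferro W) (χ : G →* ℤˣ) :
    0 ≤ ∑ g, chr χ g * W g := by
  have h : (∑ g, chr χ g * W g) * (∑ g, W g) =
      ∑ ρ, ∑ g, chr χ g * (W g * W (g * ρ)) := by
    rw [Finset.sum_comm, Finset.sum_mul]
    refine Finset.sum_congr rfl fun g _ => ?_
    rw [(Fintype.sum_equiv (Equiv.mulLeft g) _ _ fun _ => rfl :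
      ∑ ρ, W (g * ρ) = ∑ h, W h).symm, Finset.mul_sum]
    exact Finset.sum_congr rfl fun _ _ => by ring
  have h' : 0 ≤ (∑ g, chr χ g * W g) * (∑ g, W g) := by
    rw [h]; exact Finset.sum_nonneg fun ρ _ => hW.dup ρ χ
  exact nonneg_of_mul_nonneg_left h' hW.sum_pos

theorem Ferro.avg_nonneg {W : G → ℝ} (hW : Ferro W) (χ : G →* ℤˣ) : 0 ≤ avg W (chr χ) :=
  div_nonneg (hW.sum_chr_mul_nonneg χ) hW.sum_pos.le

theorem sum_mul_affine (W f : G → ℝ) (ψ : G →* ℤˣ) (t : ℝ) :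
    ∑ g, f g * (W g * (1 + t * chr ψ g)) = ∑ g, f g * W g + t * ∑ g, f g * chr ψ g * W g := by
  rw [Finset.mul_sum, ← Finset.sum_add_distrib]
  exact Finset.sum_congr rfl fun g _ => by ring

theorem sum_mul_affine' (W : G → ℝ) (ψ : G →* ℤˣ) (t : ℝ) :
    ∑ g, W g * (1 + t * chr ψ g) = ∑ g, W g + t * ∑ g, chr ψ g * W g := by
  have := sum_mul_affine W (fun _ => 1) ψ t
  simpa using this

/-- Correlations increase with the strength of each interaction. -/
theorem Ferro.avg_le_avg_affine {W : G → ℝ} (hW : Ferro W) (χ ψ : G →* ℤˣ) {t : ℝ}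
    (ht : 0 ≤ t) : avg W (chr χ) ≤ avg (fun g => W g * (1 + t * chr ψ g)) (chr χ) := by
  have hZ := hW.sum_pos
  have hψ := hW.sum_chr_mul_nonneg ψ
  rw [avg, avg, sum_mul_affine, sum_mul_affine', div_le_div_iff₀ hZ (by positivity)]
  nlinarith [mul_le_mul_of_nonneg_left (hW.gks χ ψ) ht]

/-- Correlations are concave in the strength of each interaction, hence bounded below by the
mixture of the decoupled and the fully coupled systems. -/
theorem Ferro.mix_le_avg_affine {W : G → ℝ} (hW : Ferro W) (χ ψ : G →* ℤˣ) {t p : ℝ}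
    (hp : p ≤ t) (hp0 : 0 ≤ p) (ht : t ≤ 1) :
    (1 - p) * avg W (chr χ) + p * avg (fun g => W g * (1 + chr ψ g)) (chr χ) ≤
      avg (fun g => W g * (1 + t * chr ψ g)) (chr χ) := by
  have hmono := hW.avg_le_avg_affine χ ψ zero_le_one
  simp only [one_mul] at hmono
  -- By monotonicity in the interaction it suffices to treat the weight t in place of p.
  have hle : (1 - p) * avg W (chr χ) + p * avg (fun g => W g * (1 + chr ψ g)) (chr χ) ≤
      (1 - t) * avg W (chr χ) + t * avg (fun g => W g * (1 + chr ψ g)) (chr χ) := by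
    nlinarith
  refine hle.trans ?_
  have hZ := hW.sum_pos
  have hψ := hW.sum_chr_mul_nonneg ψ
  have hg := hW.gks χ ψ
  have e1 := sum_mul_affine W (chr χ) ψ 1
  have e2 := sum_mul_affine' W ψ 1
  simp only [one_mul] at e1 e2
  have ht0 : 0 ≤ t := hp0.trans hp
  rw [avg, avg, avg, e1, e2, sum_mul_affine, sum_mul_affine']
  set Z := ∑ g, W g
  set s := ∑ g, chr ψ g * W g
  set A := ∑ g, chr χ g * W g
  set B := ∑ g, chr χ g * chr ψ g * W g
  have h1 : 0 < Z + s := by positivity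
  have h2 : 0 < Z + t * s := by positivity
  -- The average is a homographic function of t; its gap above the chord has the sign of s(BZ - As),
  -- settled by the two Griffiths inequalities.
  have : (A + t * B) / (Z + t * s) - ((1 - t) * (A / Z) + t * ((A + B) / (Z + s))) =
      t * (1 - t) * s * (B * Z - A * s) / (Z * (Z + s) * (Z + t * s)) := by
    field_simp; ring
  rw [← sub_nonneg, this]
  have h3 : 0 ≤ 1 - t := by linarith
  have h4 : 0 ≤ B * Z - A * s := by linarith
  positivity

/-- Clearing denominators leaves (exp(-K) - 1)² ≥ 0. This permits the bond probability 1 - exp(-K),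
for which the probability that many edges are closed is the exponential of a sum. -/
theorem one_sub_exp_neg_le_tanh (K : ℝ) : 1 - Real.exp (-K) ≤ Real.tanh K := by
  rw [Real.tanh_eq]
  have h1 := Real.exp_pos K
  have h2 := Real.exp_pos (-K)
  have h3 : Real.exp K * Real.exp (-K) = 1 := by rw [← Real.exp_add]; simp
  rw [le_div_iff₀ (by positivity)]
  nlinarith [sq_nonneg (Real.exp (-K) - 1)]

theorem Ferro.mix_le_avg_exp {W : G → ℝ} (hW : Ferro W) (χ ψ : G →* ℤˣ) {K p : ℝ}
    (hp0 : 0 ≤ p) (hpK : p ≤ 1 - Real.exp (-K)) :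
    (1 - p) * avg W (chr χ) + p * avg (fun g => W g * (1 + chr ψ g)) (chr χ) ≤
      avg (fun g => W g * Real.exp (-(K * (1 - chr ψ g)))) (chr χ) := by
  refine (hW.mix_le_avg_affine χ ψ (hpK.trans (one_sub_exp_neg_le_tanh K)) hp0
    (Real.tanh_lt_one K).le).trans_eq ?_
  refine (avg_congr_mul (c := Real.exp (-K) * Real.cosh K) (by positivity) (fun g => ?_) _).symm
  have hc : Real.cosh K * Real.tanh K = Real.sinh K := by
    rw [Real.tanh_eq_sinh_div_cosh]; field_simp
  have : Real.exp (-K) * Real.cosh K * (W g * (1 + Real.tanh K * chr ψ g)) =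
    W g * (Real.exp (-K) * (Real.cosh K + Real.sinh K * chr ψ g)) := by rw [← hc]; ring
  rw [this]
  congr 1
  rcases chr_eq_one_or ψ g with h | h <;> rw [h]
  · rw [mul_one, Real.cosh_add_sinh, ← Real.exp_add]; simp
  · rw [mul_neg_one, ← sub_eq_add_neg, Real.cosh_sub_sinh, ← Real.exp_add]
    congr 1; ring

end GKS

/-! ### Independent percolation on finite edge sets and its comparison with Ising correlations. -/

section Percolation

variable {E : Type*} [DecidableEq E]

/-- The expectation of `f` for independent percolation on the finite edge set `S`, where the
edge `e` is open with probability `p e`. -/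
def perc (S : Finset E) (p : E → ℝ) (f : Finset E → ℝ) : ℝ :=
  ∑ ω ∈ S.powerset, ((∏ e ∈ ω, p e) * ∏ e ∈ S \ ω, (1 - p e)) * f ω

@[simp] theorem perc_empty (p : E → ℝ) (f : Finset E → ℝ) : perc ∅ p f = f ∅ := by
  simp [perc]

/-- Conditioning on the state of a single edge; this is the recursion behind the inductions on the
edge set. -/
theorem perc_insert {e : E} {S : Finset E} (he : e ∉ S) (p : E → ℝ) (f : Finset E → ℝ) :
    perc (insert e S) p f = (1 - p e) * perc S p f + p e * perc S p fun ω => f (insert e ω) := by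
  rw [perc, Finset.sum_powerset_insert he, perc, perc, Finset.mul_sum, Finset.mul_sum]
  congr 1 <;> refine Finset.sum_congr rfl fun ω hω => ?_
  · have heω : e ∉ ω := fun h => he (Finset.mem_powerset.1 hω h)
    rw [Finset.insert_sdiff_of_notMem _ heω, Finset.prod_insert (by simp [he])]
    ring
  · have heω : e ∉ ω := fun h => he (Finset.mem_powerset.1 hω h)
    rw [Finset.prod_insert heω, Finset.insert_sdiff_insert, Finset.sdiff_insert_of_notMem he]
    ring

theorem perc_congr {S : Finset E} {p : E → ℝ} {f g : Finset E → ℝ} (h : ∀ ω ⊆ S, f ω = g ω) :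
    perc S p f = perc S p g :=
  Finset.sum_congr rfl fun ω hω => by rw [h ω (Finset.mem_powerset.1 hω)]

theorem perc_mono {S : Finset E} {p : E → ℝ} (hp0 : ∀ e, 0 ≤ p e) (hp1 : ∀ e, p e ≤ 1)
    {f g : Finset E → ℝ} (h : ∀ ω ⊆ S, f ω ≤ g ω) : perc S p f ≤ perc S p g :=
  Finset.sum_le_sum fun ω hω => mul_le_mul_of_nonneg_left (h ω (Finset.mem_powerset.1 hω))
    (mul_nonneg (Finset.prod_nonneg fun e _ => hp0 e)
      (Finset.prod_nonneg fun e _ => sub_nonneg.2 (hp1 e)))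

theorem perc_add (S : Finset E) (p : E → ℝ) (f g : Finset E → ℝ) :
    perc S p (fun ω => f ω + g ω) = perc S p f + perc S p g := by
  simp only [perc, mul_add, Finset.sum_add_distrib]

theorem perc_const_mul (S : Finset E) (p : E → ℝ) (c : ℝ) (f : Finset E → ℝ) :
    perc S p (fun ω => c * f ω) = c * perc S p f := by
  simp only [perc, Finset.mul_sum]
  exact Finset.sum_congr rfl fun ω _ => by ring

theorem perc_sum {ι : Type*} (S : Finset E) (p : E → ℝ) (I : Finset ι)
    (f : ι → Finset E → ℝ) :
    perc S p (fun ω => ∑ i ∈ I, f i ω) = ∑ i ∈ I, perc S p (f i) := by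
  simp only [perc, Finset.mul_sum]
  exact Finset.sum_comm

@[simp] theorem perc_const (S : Finset E) (p : E → ℝ) (c : ℝ) : perc S p (fun _ => c) = c := by
  induction S using Finset.induction_on with
  | empty => simp
  | insert e S he ih => rw [perc_insert he, ih]; ring

theorem perc_union {S T : Finset E} (h : Disjoint S T) (p : E → ℝ) (f : Finset E → ℝ) :
    perc (S ∪ T) p f = perc S p fun ω => perc T p fun ω' => f (ω ∪ ω') := by
  induction S using Finset.induction_on generalizing f with
  | empty => simp
  | insert e S he ih =>
    rw [Finset.disjoint_insert_left] at h
    rw [Finset.insert_union, perc_insert (by simp [he, h.1]), perc_insert he, ih h.2, ih h.2]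
    simp only [Finset.insert_union]

theorem perc_eq_of_inter {S S' : Finset E} (hS : S' ⊆ S) (p : E → ℝ) {f : Finset E → ℝ}
    (hf : ∀ ω, f (ω ∩ S') = f ω) : perc S p f = perc S' p f := by
  rw [← Finset.union_sdiff_of_subset hS, perc_union Finset.disjoint_sdiff]
  refine perc_congr fun ω hω => ?_
  rw [← perc_const (S \ S') p (f ω)]
  refine perc_congr fun ω' hω' => ?_
  rw [← hf (ω ∪ ω'), Finset.union_inter_distrib_right, Finset.inter_eq_left.2 hω,
    Finset.disjoint_iff_inter_eq_empty.1 (Finset.disjoint_of_subset_left hω'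
      Finset.sdiff_disjoint), Finset.union_empty]

theorem perc_mul_of_disjoint {S S₁ S₂ : Finset E} (h₁ : S₁ ⊆ S) (h₂ : S₂ ⊆ S)
    (hd : Disjoint S₁ S₂) (p : E → ℝ) {f g : Finset E → ℝ} (hf : ∀ ω, f (ω ∩ S₁) = f ω)
    (hg : ∀ ω, g (ω ∩ S₂) = g ω) :
    perc S p (fun ω => f ω * g ω) = perc S₁ p f * perc S₂ p g := by
  have hi1 : (S₁ ∪ S₂) ∩ S₁ = S₁ := by simp
  have hi2 : (S₁ ∪ S₂) ∩ S₂ = S₂ := by simp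
  rw [perc_eq_of_inter (Finset.union_subset h₁ h₂) p (f := fun ω => f ω * g ω) fun ω => by
    rw [← hf (ω ∩ _), ← hg (ω ∩ _), Finset.inter_assoc, Finset.inter_assoc, hi1, hi2, hf, hg],
    perc_union hd, mul_comm, ← perc_const_mul]
  refine perc_congr fun ω hω => ?_
  rw [mul_comm, ← perc_const_mul]
  refine perc_congr fun ω' hω' => ?_
  have hd' := Finset.disjoint_iff_inter_eq_empty.1 hd
  have e1 : (ω ∪ ω') ∩ S₁ = ω := by
    rw [Finset.union_inter_distrib_right, Finset.inter_eq_left.2 hω,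
      Finset.disjoint_iff_inter_eq_empty.1 (Finset.disjoint_of_subset_left hω' hd.symm),
      Finset.union_empty]
  have e2 : (ω ∪ ω') ∩ S₂ = ω' := by
    rw [Finset.union_inter_distrib_right, Finset.inter_eq_left.2 hω',
      Finset.disjoint_iff_inter_eq_empty.1 (Finset.disjoint_of_subset_left hω hd),
      Finset.empty_union]
  rw [← hf (ω ∪ ω'), ← hg (ω ∪ ω'), e1, e2]

/-- The probability of the event `A`. -/
def prob (S : Finset E) (p : E → ℝ) (A : Set (Finset E)) : ℝ :=
  perc S p (A.indicator fun _ => 1)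

theorem indicator_inter_of_iff {S' : Finset E} {A : Set (Finset E)}
    (hA : ∀ ω, ω ∩ S' ∈ A ↔ ω ∈ A) (ω : Finset E) :
    A.indicator (fun _ => (1 : ℝ)) (ω ∩ S') = A.indicator (fun _ => 1) ω := by
  by_cases h : ω ∈ A
  · rw [Set.indicator_of_mem h, Set.indicator_of_mem ((hA ω).2 h)]
  · rw [Set.indicator_of_notMem h, Set.indicator_of_notMem fun h' => h ((hA ω).1 h')]

theorem prob_eq_of_inter {S S' : Finset E} (hS : S' ⊆ S) (p : E → ℝ) {A : Set (Finset E)}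
    (hA : ∀ ω, ω ∩ S' ∈ A ↔ ω ∈ A) : prob S p A = prob S' p A :=
  perc_eq_of_inter hS p (indicator_inter_of_iff hA)

theorem prob_inter_of_disjoint {S S₁ S₂ : Finset E} (h₁ : S₁ ⊆ S) (h₂ : S₂ ⊆ S)
    (hd : Disjoint S₁ S₂) (p : E → ℝ) {A B : Set (Finset E)} (hA : ∀ ω, ω ∩ S₁ ∈ A ↔ ω ∈ A)
    (hB : ∀ ω, ω ∩ S₂ ∈ B ↔ ω ∈ B) : prob S p (A ∩ B) = prob S₁ p A * prob S₂ p B := by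
  rw [prob, prob, prob, ← perc_mul_of_disjoint h₁ h₂ hd p (indicator_inter_of_iff hA)
    (indicator_inter_of_iff hB)]
  refine perc_congr fun ω _ => ?_
  by_cases h : ω ∈ A <;> by_cases h' : ω ∈ B <;> simp [h, h']

theorem prob_closed {S T : Finset E} (hT : T ⊆ S) (p : E → ℝ) :
    prob S p {ω | Disjoint ω T} = ∏ e ∈ T, (1 - p e) := by
  rw [prob_eq_of_inter hT p fun ω => by
    simp only [Set.mem_ofPred_eq, Finset.disjoint_iff_inter_eq_empty, Finset.inter_assoc,
      Finset.inter_self], prob, perc, Finset.sum_eq_single ∅]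
  · simp
  · intro ω hω hne
    rw [Set.indicator_of_notMem, mul_zero]
    exact fun h => hne (Finset.disjoint_self_iff_empty _ |>.1
      (Finset.disjoint_of_subset_right (Finset.mem_powerset.1 hω) h))
  · simp

theorem prob_mono {S : Finset E} {p : E → ℝ} (hp0 : ∀ e, 0 ≤ p e) (hp1 : ∀ e, p e ≤ 1)
    {A B : Set (Finset E)} (h : ∀ ω ⊆ S, ω ∈ A → ω ∈ B) : prob S p A ≤ prob S p B := by
  refine perc_mono hp0 hp1 fun ω hω => ?_
  by_cases hA : ω ∈ A
  · rw [Set.indicator_of_mem hA, Set.indicator_of_mem (h ω hω hA)]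
  · rw [Set.indicator_of_notMem hA]
    exact Set.indicator_nonneg (fun _ _ => zero_le_one) _

theorem prob_compl (S : Finset E) (p : E → ℝ) (A : Set (Finset E)) :
    prob S p Aᶜ = 1 - prob S p A := by
  have : prob S p A + prob S p Aᶜ = 1 := by
    rw [prob, prob, ← perc_add, ← perc_const S p 1]
    exact perc_congr fun ω _ => by
      by_cases hA : ω ∈ A <;> simp [hA]
  linarith

theorem prob_nonneg {S : Finset E} {p : E → ℝ} (hp0 : ∀ e, 0 ≤ p e) (hp1 : ∀ e, p e ≤ 1)
    (A : Set (Finset E)) : 0 ≤ prob S p A := by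
  rw [← perc_const S p 0]
  exact perc_mono hp0 hp1 fun ω _ => Set.indicator_nonneg (fun _ _ => zero_le_one) _

/-- The union bound for an event covered by two finite families of events. -/
theorem prob_le_sum_add_sum {ι κ : Type*} {S : Finset E} {p : E → ℝ} (hp0 : ∀ e, 0 ≤ p e)
    (hp1 : ∀ e, p e ≤ 1) {A : Set (Finset E)} (I : Finset ι) (B : ι → Set (Finset E))
    (J : Finset κ) (D : κ → Set (Finset E))
    (h : ∀ ω ∈ A, (∃ i ∈ I, ω ∈ B i) ∨ ∃ j ∈ J, ω ∈ D j) :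
    prob S p A ≤ ∑ i ∈ I, prob S p (B i) + ∑ j ∈ J, prob S p (D j) := by
  simp only [prob]
  rw [← perc_sum, ← perc_sum, ← perc_add]
  refine perc_mono hp0 hp1 fun ω _ => ?_
  have hn : ∀ C : Set (Finset E), 0 ≤ C.indicator (fun _ => (1 : ℝ)) ω := fun C =>
    Set.indicator_nonneg (fun _ _ => zero_le_one) _
  have hI := Finset.sum_nonneg fun i (_ : i ∈ I) => hn (B i)
  have hJ := Finset.sum_nonneg fun j (_ : j ∈ J) => hn (D j)
  by_cases hA : ω ∈ A
  · rw [Set.indicator_of_mem hA]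
    rcases h ω hA with ⟨i, hi, hω⟩ | ⟨j, hj, hω⟩
    · have := Finset.single_le_sum (fun i (_ : i ∈ I) => hn (B i)) hi
      rw [Set.indicator_of_mem hω] at this
      linarith
    · have := Finset.single_le_sum (fun j (_ : j ∈ J) => hn (D j)) hj
      rw [Set.indicator_of_mem hω] at this
      linarith
  · rw [Set.indicator_of_notMem hA]; linarith

theorem prob_map {E' : Type*} [DecidableEq E'] (φ : E ↪ E') (S : Finset E) (p : E' → ℝ)
    (A : Set (Finset E')) :
    prob (S.map φ) p A = prob S (fun e => p (φ e)) {ω | ω.map φ ∈ A} := by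
  have : ∀ f : Finset E' → ℝ,
      perc (S.map φ) p f = perc S (fun e => p (φ e)) fun ω => f (ω.map φ) := by
    induction S using Finset.induction_on with
    | empty => simp
    | insert e S he ih =>
      intro f
      rw [Finset.map_insert, perc_insert (by simpa using he), perc_insert he, ih, ih]
      simp only [Finset.map_insert]
  rw [prob, this]
  rfl

/-- An Ising correlation dominates the probability that the open edges force it to be `1`. -/
theorem Ferro.prob_le_avg_exp_sum {G : Type*} [CommGroup G] [Fintype G] (S : Finset E)
    (ψ : E → G →* ℤˣ) (K p : E → ℝ) (hp0 : ∀ e, 0 ≤ p e) (hpK : ∀ e ∈ S, p e ≤ 1 - Real.exp (-K e))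
    (hp1 : ∀ e, p e ≤ 1) (χ : G →* ℤˣ) {W : G → ℝ} (hW : Ferro W) :
    prob S p {ω | ∀ g, (∀ e ∈ ω, ψ e g = 1) → χ g = 1} ≤
      avg (fun g => W g * Real.exp (-∑ e ∈ S, K e * (1 - chr (ψ e) g))) (chr χ) := by
  -- Induction on the edges: `Ferro.mix_le_avg_exp` replaces one interaction by a mixture. The
  -- weight W is kept general because the locked case absorbs the factor 1 + ψ into it.
  have main : ∀ W : G → ℝ, Ferro W →
      perc S p (fun ω => avg (fun g => W g * ∏ e ∈ ω, (1 + chr (ψ e) g)) (chr χ)) ≤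
      avg (fun g => W g * Real.exp (-∑ e ∈ S, K e * (1 - chr (ψ e) g))) (chr χ) := by
    induction S using Finset.induction_on with
    | empty => intro W _; simp
    | insert e S he ih =>
      intro W hW
      have hK : 0 ≤ K e := by
        have := (hp0 e).trans (hpK e (Finset.mem_insert_self _ _))
        by_contra hneg
        have := Real.one_lt_exp_iff.2 (show 0 < -K e by linarith)
        linarith
      have hKS : ∀ i ∈ S, 0 ≤ K i := fun i hi => by
        have := (hp0 i).trans (hpK i (Finset.mem_insert_of_mem hi))
        by_contra hneg
        have := Real.one_lt_exp_iff.2 (show 0 < -K i by linarith)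
        linarith
      have ih' := ih fun i hi => hpK i (Finset.mem_insert_of_mem hi)
      have hWS : Ferro fun g => W g * Real.exp (-∑ e ∈ S, K e * (1 - chr (ψ e) g)) := by
        have := hW.mul_exp_sum S (fun i => max (K i) 0) (fun i => le_max_right _ _) ψ
        convert this using 5 with g
        exact Finset.sum_congr rfl fun i hi => by rw [max_eq_left (hKS i hi)]
      have h1 := ih' W hW
      have hWe : Ferro fun g => W g * (1 + chr (ψ e) g) := by
        simpa using hW.mul_affine (ψ e) zero_lt_one zero_le_one le_rfl
      have h2 := ih' _ hWe
      have h3 := hWS.mix_le_avg_exp χ (ψ e) (hp0 e) (hpK e (Finset.mem_insert_self _ _))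
      rw [perc_insert he]
      have e1 : (fun g => W g * Real.exp (-∑ e ∈ insert e S, K e * (1 - chr (ψ e) g))) =
          fun g => W g * Real.exp (-∑ e ∈ S, K e * (1 - chr (ψ e) g)) *
            Real.exp (-(K e * (1 - chr (ψ e) g))) := by
        funext g
        rw [Finset.sum_insert he, mul_assoc, ← Real.exp_add, neg_add_rev]
      have e2 : perc S p (fun ω => avg (fun g => W g * ∏ e ∈ insert e ω, (1 + chr (ψ e) g))
          (chr χ)) = perc S p fun ω => avg
            (fun g => W g * (1 + chr (ψ e) g) * ∏ e ∈ ω, (1 + chr (ψ e) g)) (chr χ) := by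
        refine perc_congr fun ω hω => ?_
        have heω : e ∉ ω := fun h => he (hω h)
        simp only [Finset.prod_insert heω, mul_assoc]
      rw [e1, e2]
      refine le_trans (add_le_add (mul_le_mul_of_nonneg_left h1 (sub_nonneg.2 (hp1 e)))
        (mul_le_mul_of_nonneg_left h2 (hp0 e))) (le_trans (le_of_eq ?_) h3)
      simp only [mul_right_comm]
  -- For fixed ω the factors 1 + ψ vanish unless every open constraint holds. The average is then 1
  -- if the constraints force χ = 1, and nonnegative otherwise by the first Griffiths inequality.
  refine le_trans (perc_mono hp0 hp1 fun ω _ => ?_) (main W hW)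
  have hWω : Ferro fun g => W g * ∏ e ∈ ω, (1 + chr (ψ e) g) := by
    clear * - hW
    induction ω using Finset.induction_on with
    | empty => simpa using hW
    | insert e ω he ih =>
      have := ih.mul_affine (ψ e) zero_lt_one zero_le_one le_rfl
      simp only [Finset.prod_insert he]
      convert this using 2 with g
      ring
  by_cases hω : ω ∈ {ω : Finset E | ∀ g, (∀ e ∈ ω, ψ e g = 1) → χ g = 1}
  · rw [Set.indicator_of_mem hω, avg, le_div_iff₀ hWω.sum_pos, one_mul]
    refine Finset.sum_le_sum fun g _ => ?_
    by_cases hg : ∀ e ∈ ω, ψ e g = 1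
    · rw [chr, hω g hg]; simp
    · push Not at hg
      obtain ⟨e, he, hne⟩ := hg
      have : chr (ψ e) g = -1 := by
        rcases Int.units_eq_one_or (ψ e g) with h | h
        · exact absurd h hne
        · simp [chr, h]
      rw [Finset.prod_eq_zero he (by rw [this]; norm_num)]; simp
  · rw [Set.indicator_of_notMem hω]
    exact hWω.avg_nonneg χ

end Percolation

/-! ### Clusters in intervals and their merging along chains of overlapping blocks. -/

section Clusters

/-- The pairs `x < y` of sites of `V`. -/
def edgesIn (V : Finset ℤ) : Finset (ℤ × ℤ) := (V ×ˢ V).filter fun e => e.1 < e.2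

theorem mem_edgesIn {V : Finset ℤ} {e : ℤ × ℤ} :
    e ∈ edgesIn V ↔ e.1 ∈ V ∧ e.2 ∈ V ∧ e.1 < e.2 := by
  simp [edgesIn, and_assoc]

theorem edgesIn_mono {V U : Finset ℤ} (h : V ⊆ U) : edgesIn V ⊆ edgesIn U := fun e he => by
  rw [mem_edgesIn] at he ⊢
  exact ⟨h he.1, h he.2.1, he.2.2⟩

theorem disjoint_edgesIn {V U : Finset ℤ} (h : Disjoint V U) :
    Disjoint (edgesIn V) (edgesIn U) :=
  Finset.disjoint_left.2 fun _ he he' =>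
    Finset.disjoint_left.1 h (mem_edgesIn.1 he).1 (mem_edgesIn.1 he').1

/-- Two sites are connected by open edges. -/
def Conn (ω : Finset (ℤ × ℤ)) (x y : ℤ) : Prop := Relation.EqvGen (fun u v => (u, v) ∈ ω) x y

theorem Conn.mono {ω ω' : Finset (ℤ × ℤ)} (h : ω ⊆ ω') {x y : ℤ} (hc : Conn ω x y) :
    Conn ω' x y := Relation.EqvGen.mono (fun _ _ hm => h hm) _ _ hc

/-- `C` is a set of sites of `V`, all connected to each other inside `V`. -/
def IsCluster (ω : Finset (ℤ × ℤ)) (V C : Finset ℤ) : Prop :=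
  C ⊆ V ∧ ∀ x ∈ C, ∀ y ∈ C, Conn (ω ∩ edgesIn V) x y

/-- There is a cluster of at least `m` sites in `V`. -/
def Good (ω : Finset (ℤ × ℤ)) (V : Finset ℤ) (m : ℝ) : Prop :=
  ∃ C, IsCluster ω V C ∧ m ≤ C.card

theorem isCluster_congr {ω ω' : Finset (ℤ × ℤ)} {V : Finset ℤ}
    (h : ω ∩ edgesIn V = ω' ∩ edgesIn V) (C : Finset ℤ) :
    IsCluster ω V C ↔ IsCluster ω' V C := by
  rw [IsCluster, IsCluster, h]

theorem good_inter_edgesIn (ω : Finset (ℤ × ℤ)) (V : Finset ℤ) (m : ℝ) :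
    Good (ω ∩ edgesIn V) V m ↔ Good ω V m := by
  simp only [Good, isCluster_congr (show ω ∩ edgesIn V ∩ edgesIn V = ω ∩ edgesIn V by
    rw [Finset.inter_assoc, Finset.inter_self])]

theorem IsCluster.union {ω : Finset (ℤ × ℤ)} {V V' U C D : Finset ℤ} (hC : IsCluster ω V C)
    (hD : IsCluster ω V' D) (hV : V ⊆ U) (hV' : V' ⊆ U) {x y : ℤ} (hx : x ∈ C) (hy : y ∈ D)
    (hxy : Conn (ω ∩ edgesIn U) x y) : IsCluster ω U (C ∪ D) := by
  refine ⟨Finset.union_subset (hC.1.trans hV) (hD.1.trans hV'), ?_⟩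
  have hto : ∀ z ∈ C ∪ D, Conn (ω ∩ edgesIn U) z x := by
    intro z hz
    rcases Finset.mem_union.1 hz with hz | hz
    · exact (hC.2 z hz x hx).mono (Finset.inter_subset_inter_left (edgesIn_mono hV))
    · exact ((hD.2 z hz y hy).mono (Finset.inter_subset_inter_left (edgesIn_mono hV'))).trans
        _ _ _ (hxy.symm _ _)
  exact fun z hz w hw => (hto z hz).trans _ _ _ ((hto w hw).symm _ _)

/-- Blocks made of the `j`-th and the `(j + 1)`-st interval of length `h` after `a`. -/
def hblock (a : ℤ) (h : ℕ) (j : ℤ) : Finset ℤ := Finset.Ico (a + j * h) (a + (j + 2) * h)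

/-- Pigeonhole: disjoint sets would occupy at least 2 · (7/8) · 2h = 7h/2 sites of an interval with
3h sites. -/
theorem exists_mem_inter_of_card {u : ℤ} {h : ℕ} {θ : ℝ} (hh : 0 < h) (hθ : 7 / 8 ≤ θ)
    {C D : Finset ℤ} (hC : C ⊆ Finset.Ico u (u + 2 * h))
    (hD : D ⊆ Finset.Ico (u + h) (u + 3 * h)) (hC' : θ * (2 * h) ≤ C.card)
    (hD' : θ * (2 * h) ≤ D.card) : ∃ z ∈ C, z ∈ D := by
  by_contra hne
  push Not at hne
  have hd : Disjoint C D := Finset.disjoint_left.2 hne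
  have hsub : C ∪ D ⊆ Finset.Ico u (u + 3 * h) := by
    intro z hz
    rcases Finset.mem_union.1 hz with hz | hz
    · have := Finset.mem_Ico.1 (hC hz); rw [Finset.mem_Ico]; omega
    · have := Finset.mem_Ico.1 (hD hz); rw [Finset.mem_Ico]; omega
  have hcard := Finset.card_le_card hsub
  rw [Finset.card_union_of_disjoint hd, Int.card_Ico] at hcard
  have h3 : C.card + D.card ≤ 3 * h := by omega
  have h3' : (C.card : ℝ) + D.card ≤ 3 * h := by exact_mod_cast h3
  have hh' : (0 : ℝ) < h := by exact_mod_cast hh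
  nlinarith

/-- Consecutive blocks overlap in half their length, so their dense clusters share a site and merge.
Density in every block is carried along, both to continue the chain and to estimate interactions
later. -/
theorem exists_isCluster_chain {a : ℤ} {h : ℕ} {θ : ℝ} (hh : 0 < h) (hθ : 7 / 8 ≤ θ)
    {ω : Finset (ℤ × ℤ)} (s : ℤ) (n : ℕ)
    (hg : ∀ i : ℕ, i ≤ n → Good ω (hblock a h (s + i)) (θ * (2 * h))) :
    ∃ C, IsCluster ω (Finset.Ico (a + s * h) (a + (s + n + 2) * h)) C ∧
      ∀ i : ℕ, i ≤ n → θ * (2 * h) ≤ (C ∩ hblock a h (s + i)).card := by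
  induction n with
  | zero =>
    obtain ⟨C, hC, hc⟩ := hg 0 le_rfl
    refine ⟨C, by simpa [hblock] using hC, fun i hi => ?_⟩
    obtain rfl : i = 0 := by omega
    rwa [Finset.inter_eq_left.2 hC.1]
  | succ n ih =>
    obtain ⟨C, hC, hc⟩ := ih fun i hi => hg i (by omega)
    obtain ⟨D, hD, hd⟩ := hg (n + 1) le_rfl
    have hh' : (0 : ℤ) < h := by exact_mod_cast hh
    obtain ⟨z, hzC, hzD⟩ := exists_mem_inter_of_card (u := a + (s + n) * h) hh hθ
      (C := C ∩ hblock a h (s + n)) (D := D)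
      (Finset.inter_subset_right.trans (by
        rw [hblock]; exact Finset.Ico_subset_Ico le_rfl (by nlinarith)))
      (hD.1.trans (by
        rw [hblock]; push_cast; exact Finset.Ico_subset_Ico (by nlinarith) (by nlinarith)))
      (hc n le_rfl) hd
    refine ⟨C ∪ D, hC.union hD ?_ ?_ (Finset.mem_inter.1 hzC).1 hzD (Relation.EqvGen.refl _), ?_⟩
    · push_cast; exact Finset.Ico_subset_Ico le_rfl (by nlinarith)
    · rw [hblock]; push_cast; exact Finset.Ico_subset_Ico (by nlinarith) (by nlinarith)
    · intro i hi
      rcases Nat.lt_or_ge n i with hi' | hi'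
      · obtain rfl : i = n + 1 := by omega
        refine hd.trans (Nat.cast_le.2 (Finset.card_le_card ?_))
        exact Finset.subset_inter Finset.subset_union_right hD.1
      · refine (hc i hi').trans (Nat.cast_le.2 (Finset.card_le_card ?_))
        exact Finset.inter_subset_inter_right Finset.subset_union_left

theorem sum_biUnion_le {ι κ : Type*} [DecidableEq κ] {I : Finset ι} {T : ι → Finset κ}
    (hd : (I : Set ι).PairwiseDisjoint T) {C : Finset κ} {f : κ → ℝ} (hf : ∀ x ∈ C, 0 ≤ f x) :
    ∑ i ∈ I, ∑ x ∈ C ∩ T i, f x ≤ ∑ x ∈ C, f x := by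
  rw [← Finset.sum_biUnion fun i hi j hj hij =>
    (hd hi hj hij).mono Finset.inter_subset_right Finset.inter_subset_right]
  exact Finset.sum_le_sum_of_subset_of_nonneg
    (Finset.biUnion_subset.2 fun _ _ => Finset.inter_subset_left) fun x hx _ => hf x hx

theorem disjoint_hblock (a : ℤ) (h : ℕ) {i j : ℤ} (hij : i + 2 ≤ j) :
    Disjoint (hblock a h i) (hblock a h j) := by
  refine Finset.disjoint_left.2 fun x hx hx' => ?_
  rw [hblock, Finset.mem_Ico] at hx hx'
  have : (i + 2) * (h : ℤ) ≤ j * h := mul_le_mul_of_nonneg_right hij (by positivity)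
  linarith

/-- Every second block is counted, since these are disjoint; there are ⌊(n + 2)/2⌋ ≥ (n + 1)/2 of
them. -/
theorem le_card_of_chain {a : ℤ} {h : ℕ} {m : ℝ} (hm : 0 ≤ m) {C : Finset ℤ} (s : ℤ) (n : ℕ)
    (hc : ∀ i : ℕ, i ≤ n → m * (2 * h) ≤ (C ∩ hblock a h (s + i)).card) :
    (n + 1) * (m * h) ≤ C.card := by
  have h1 := sum_biUnion_le (I := Finset.range ((n + 2) / 2))
    (T := fun i => hblock a h (s + (2 * i : ℕ))) (C := C) (f := fun _ => 1)
    (fun i _ j _ hij => by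
      rcases Nat.lt_or_gt_of_ne hij with hij | hij
      · exact disjoint_hblock a h (by push_cast; omega)
      · exact (disjoint_hblock a h (by push_cast; omega)).symm) fun _ _ => zero_le_one
  simp only [Finset.sum_const, nsmul_eq_mul, mul_one] at h1
  have h2 := Finset.card_nsmul_le_sum (Finset.range ((n + 2) / 2))
    (fun i => ((C ∩ hblock a h (s + (2 * i : ℕ))).card : ℝ)) (m * (2 * h)) fun i hi =>
      hc (2 * i) (by have := Finset.mem_range.1 hi; omega)
  rw [Finset.card_range, nsmul_eq_mul] at h2
  refine le_trans ?_ (h2.trans h1)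
  have h3 : n + 1 ≤ 2 * ((n + 2) / 2) := by omega
  have h3' : ((n : ℝ) + 1) ≤ 2 * (((n + 2) / 2 : ℕ) : ℝ) := by exact_mod_cast h3
  have h4 : 0 ≤ m * h := by positivity
  nlinarith

end Clusters

/-! ### The probability that two dense clusters facing each other are not joined. -/

section Splitting

/-- The probability that an edge is open. -/
def bondProb (b : ℝ) (e : ℤ × ℤ) : ℝ := 1 - Real.exp (-(b / ((e.2 - e.1 : ℤ) : ℝ) ^ 2))

theorem bondProb_nonneg {b : ℝ} (hb : 0 ≤ b) (e : ℤ × ℤ) : 0 ≤ bondProb b e := by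
  rw [bondProb, sub_nonneg, Real.exp_le_one_iff]
  have : 0 ≤ b / ((e.2 - e.1 : ℤ) : ℝ) ^ 2 := by positivity
  linarith

theorem bondProb_le_one (b : ℝ) (e : ℤ × ℤ) : bondProb b e ≤ 1 := by
  have := Real.exp_pos (-(b / ((e.2 - e.1 : ℤ) : ℝ) ^ 2))
  rw [bondProb]; linarith

/-- Conditionally on the inside of two regions, the edges between them are independent: large
clusters of the two regions are unlikely to stay unconnected. -/
theorem prob_split_le {p : ℤ × ℤ → ℝ} (hp0 : ∀ e, 0 ≤ p e) (hp1 : ∀ e, p e ≤ 1)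
    {VL VR V : Finset ℤ} (hL : VL ⊆ V) (hR : VR ⊆ V) (hlt : ∀ x ∈ VL, ∀ y ∈ VR, x < y)
    (P Q : Finset ℤ → Prop) {q : ℝ} (hq0 : 0 ≤ q)
    (hq : ∀ C ⊆ VL, ∀ D ⊆ VR, P C → Q D → ∏ e ∈ C ×ˢ D, (1 - p e) ≤ q) :
    prob (edgesIn V) p {ω | (∃ C, IsCluster ω VL C ∧ P C) ∧ (∃ D, IsCluster ω VR D ∧ Q D) ∧
      ∀ C D, IsCluster ω VL C → P C → IsCluster ω VR D → Q D → Disjoint ω (C ×ˢ D)} ≤ q := by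
  set A : Set (Finset (ℤ × ℤ)) := {ω | (∃ C, IsCluster ω VL C ∧ P C) ∧
    (∃ D, IsCluster ω VR D ∧ Q D) ∧ ∀ C D, IsCluster ω VL C → P C → IsCluster ω VR D → Q D →
      Disjoint ω (C ×ˢ D)} with hA
  set S := edgesIn VL ∪ edgesIn VR with hS
  have hsub : S ⊆ edgesIn V := Finset.union_subset (edgesIn_mono hL) (edgesIn_mono hR)
  -- The edges inside the two regions are frozen first. They determine the clusters, and the edges
  -- between the regions are independent of them.
  rw [prob, ← Finset.union_sdiff_of_subset hsub, perc_union Finset.disjoint_sdiff,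
    ← perc_const S p q]
  refine perc_mono hp0 hp1 fun ω hω => ?_
  have hext : ∀ U, edgesIn U ⊆ S → ∀ ω' ⊆ edgesIn V \ S, ∀ C,
      IsCluster (ω ∪ ω') U C ↔ IsCluster ω U C := by
    intro U hU ω' hω' C
    refine isCluster_congr ?_ C
    rw [Finset.union_inter_distrib_right, Finset.disjoint_iff_inter_eq_empty.1
      ((Finset.disjoint_of_subset_left hω' Finset.sdiff_disjoint).mono_right hU),
      Finset.union_empty]
  have hextL := hext VL Finset.subset_union_left
  have hextR := hext VR Finset.subset_union_right
  by_cases hex : (∃ C, IsCluster ω VL C ∧ P C) ∧ ∃ D, IsCluster ω VR D ∧ Q D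
  -- A single pair (C, D), chosen from the frozen edges alone, suffices: all edges of C × D must be
  -- closed.
  · obtain ⟨⟨C, hC, hPC⟩, D, hD, hQD⟩ := hex
    have hCD : C ×ˢ D ⊆ edgesIn V \ S := by
      intro e he
      obtain ⟨h1, h2⟩ := Finset.mem_product.1 he
      have h12 := hlt _ (hC.1 h1) _ (hD.1 h2)
      rw [Finset.mem_sdiff, hS, Finset.mem_union, mem_edgesIn, mem_edgesIn, mem_edgesIn]
      refine ⟨⟨hL (hC.1 h1), hR (hD.1 h2), h12⟩, ?_⟩
      rintro (⟨_, h, _⟩ | ⟨h, _, _⟩)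
      · exact lt_irrefl _ (hlt _ h _ (hD.1 h2))
      · exact lt_irrefl _ (hlt _ (hC.1 h1) _ h)
    refine le_trans ?_ (hq C hC.1 D hD.1 hPC hQD)
    rw [← prob_closed hCD p, prob]
    refine perc_mono hp0 hp1 fun ω' hω' => ?_
    by_cases hm : ω ∪ ω' ∈ A
    · rw [Set.indicator_of_mem hm, Set.indicator_of_mem]
      exact Finset.disjoint_of_subset_left Finset.subset_union_right
        (hm.2.2 C D ((hextL ω' hω' C).2 hC) hPC ((hextR ω' hω' D).2 hD) hQD)
    · rw [Set.indicator_of_notMem hm]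
      exact Set.indicator_nonneg (fun _ _ => zero_le_one) _
  · rw [← perc_const (edgesIn V \ S) p q]
    refine perc_mono hp0 hp1 fun ω' hω' => ?_
    rw [Set.indicator_of_notMem]
    · exact hq0
    · rintro ⟨⟨C, hC, hPC⟩, ⟨D, hD, hQD⟩, -⟩
      exact hex ⟨⟨C, (hextL ω' hω' C).1 hC, hPC⟩, D, (hextR ω' hω' D).1 hD, hQD⟩

/-- The interaction between two sets that are dense on all scales, on the two sides of a gap,
grows like the logarithm of the number of scales. -/
theorem log_le_sum_inv_sq {a i : ℤ} {h M : ℕ} (hh : 0 < h) {C D : Finset ℤ}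
    (hC : ∀ u : ℕ, u < M → (h : ℝ) ≤ (C ∩ hblock a h (i - 2 - 2 * u)).card)
    (hD : ∀ v : ℕ, v < M → (h : ℝ) ≤ (D ∩ hblock a h (i + 2 + 2 * v)).card) :
    Real.log (M + 1) / 36 ≤ ∑ e ∈ C ×ˢ D, 1 / ((e.2 - e.1 : ℤ) : ℝ) ^ 2 := by
  have hh' : (0 : ℝ) < h := by exact_mod_cast hh
  have hL : (Finset.range M : Set ℕ).PairwiseDisjoint fun u : ℕ => hblock a h (i - 2 - 2 * u) := by
    intro u _ v _ huv
    rcases Nat.lt_or_gt_of_ne huv with huv | huv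
    · exact (disjoint_hblock a h (by omega)).symm
    · exact disjoint_hblock a h (by omega)
  have hR : (Finset.range M : Set ℕ).PairwiseDisjoint fun v : ℕ => hblock a h (i + 2 + 2 * v) := by
    intro u _ v _ huv
    rcases Nat.lt_or_gt_of_ne huv with huv | huv
    · exact disjoint_hblock a h (by omega)
    · exact (disjoint_hblock a h (by omega)).symm
  have hpair : ∀ u v : ℕ, u < M → v < M →
      1 / (4 * ((u : ℝ) + v + 3) ^ 2) ≤ ∑ x ∈ C ∩ hblock a h (i - 2 - 2 * u),
        ∑ y ∈ D ∩ hblock a h (i + 2 + 2 * v), 1 / ((y - x : ℤ) : ℝ) ^ 2 := by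
    intro u v hu hv
    have hterm : ∀ x ∈ C ∩ hblock a h (i - 2 - 2 * u), ∀ y ∈ D ∩ hblock a h (i + 2 + 2 * v),
        1 / (4 * ((u : ℝ) + v + 3) ^ 2 * h ^ 2) ≤ 1 / ((y - x : ℤ) : ℝ) ^ 2 := by
      intro x hx y hy
      have hx' := Finset.mem_Ico.1 (Finset.mem_inter.1 hx).2
      have hy' := Finset.mem_Ico.1 (Finset.mem_inter.1 hy).2
      have h0 : 0 < y - x := by
        have : (0 : ℤ) < h := by exact_mod_cast hh
        nlinarith
      -- The two blocks together span from (i - 2 - 2u)h to (i + 4 + 2v)h. With at least h sites on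
      -- each side, the h² pairs cancel the h² of the squared distance.
      have h1 : y - x ≤ 2 * (u + v + 3) * h := by nlinarith
      have h0' : (0 : ℝ) < ((y - x : ℤ) : ℝ) := by exact_mod_cast h0
      have h1' : ((y - x : ℤ) : ℝ) ≤ 2 * (u + v + 3) * h := by exact_mod_cast h1
      refine one_div_le_one_div_of_le (by positivity) ?_
      calc ((y - x : ℤ) : ℝ) ^ 2 ≤ (2 * (u + v + 3) * h) ^ 2 := by gcongr
        _ = _ := by ring
    have hin : ∀ x ∈ C ∩ hblock a h (i - 2 - 2 * u),
        h * (1 / (4 * ((u : ℝ) + v + 3) ^ 2 * h ^ 2)) ≤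
          ∑ y ∈ D ∩ hblock a h (i + 2 + 2 * v), 1 / ((y - x : ℤ) : ℝ) ^ 2 := fun x hx => by
      refine le_trans ?_ (Finset.card_nsmul_le_sum _ _ _ (hterm x hx))
      rw [nsmul_eq_mul]
      exact mul_le_mul_of_nonneg_right (hD v hv) (by positivity)
    refine le_trans ?_ (Finset.card_nsmul_le_sum _ _ _ hin)
    rw [nsmul_eq_mul]
    refine le_trans (le_of_eq ?_) (mul_le_mul_of_nonneg_right (hC u hu) (by positivity))
    field_simp
  have hsum : ∑ u ∈ Finset.range M, ∑ v ∈ Finset.range M, 1 / (4 * ((u : ℝ) + v + 3) ^ 2) ≤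
      ∑ e ∈ C ×ˢ D, 1 / ((e.2 - e.1 : ℤ) : ℝ) ^ 2 := by
    rw [Finset.sum_product]
    refine le_trans ?_ (sum_biUnion_le hL fun x _ =>
      Finset.sum_nonneg fun y _ => by positivity)
    refine Finset.sum_le_sum fun u hu => ?_
    have : ∀ x ∈ C ∩ hblock a h (i - 2 - 2 * u), ∑ v ∈ Finset.range M,
        ∑ y ∈ D ∩ hblock a h (i + 2 + 2 * v), 1 / ((y - x : ℤ) : ℝ) ^ 2 ≤
        ∑ y ∈ D, 1 / ((y - x : ℤ) : ℝ) ^ 2 := fun x _ =>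
      sum_biUnion_le hR fun y _ => by positivity
    refine le_trans ?_ (Finset.sum_le_sum this)
    rw [Finset.sum_comm]
    exact Finset.sum_le_sum fun v hv =>
      hpair u v (Finset.mem_range.1 hu) (Finset.mem_range.1 hv)
  refine le_trans ?_ hsum
  have hharm := log_add_one_le_harmonic M
  rw [harmonic] at hharm
  push_cast at hharm
  -- Only v ≤ u is kept, where u + v + 3 ≤ 3(u + 1): this gives u + 1 terms, each at least 1/(36(u +
  -- 1)²).
  have : (∑ u ∈ Finset.range M, ((u : ℝ) + 1)⁻¹) / 36 ≤
      ∑ u ∈ Finset.range M, ∑ v ∈ Finset.range M, 1 / (4 * ((u : ℝ) + v + 3) ^ 2) := by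
    rw [Finset.sum_div]
    refine Finset.sum_le_sum fun u hu => ?_
    have hu' := Finset.mem_range.1 hu
    refine le_trans ?_ (Finset.sum_le_sum_of_subset_of_nonneg
      (Finset.range_mono (show u + 1 ≤ M by omega)) fun v _ _ => by positivity)
    have hv : ∀ v ∈ Finset.range (u + 1), 1 / (36 * ((u : ℝ) + 1) ^ 2) ≤
        1 / (4 * ((u : ℝ) + v + 3) ^ 2) := fun v hv => by
      have hv' : (v : ℝ) ≤ u := by
        exact_mod_cast (show v ≤ u by have := Finset.mem_range.1 hv; omega)
      refine one_div_le_one_div_of_le (by positivity) ?_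
      have hv0 : (0 : ℝ) ≤ v := by positivity
      nlinarith
    refine le_trans (le_of_eq ?_) (Finset.card_nsmul_le_sum _ _ _ hv)
    rw [Finset.card_range, nsmul_eq_mul]
    push_cast
    field_simp
  linarith

theorem prod_closed_le {b : ℝ} (hb : 0 ≤ b) {a i : ℤ} {h M : ℕ} (hh : 0 < h) {C D : Finset ℤ}
    (hC : ∀ u : ℕ, u < M → (h : ℝ) ≤ (C ∩ hblock a h (i - 2 - 2 * u)).card)
    (hD : ∀ v : ℕ, v < M → (h : ℝ) ≤ (D ∩ hblock a h (i + 2 + 2 * v)).card) :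
    ∏ e ∈ C ×ˢ D, (1 - bondProb b e) ≤ ((M : ℝ) + 1) ^ (-(b / 36)) := by
  simp only [bondProb, sub_sub_cancel]
  rw [← Real.exp_sum, Real.rpow_def_of_pos (by positivity), Real.exp_le_exp,
    Finset.sum_neg_distrib]
  have h1 := mul_le_mul_of_nonneg_left (log_le_sum_inv_sq hh hC hD) hb
  rw [Finset.mul_sum] at h1
  simp only [mul_one_div] at h1
  linarith

end Splitting

/-! ### The renormalization step from blocks of length 2h to blocks of length 2Rh. -/

section Renormalization

/-- Both sides of the `i`-th block of `[a, a + N h)` contain clusters that are dense in all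
the smaller blocks, and no open edge joins two such clusters. -/
def splitEvent (a : ℤ) (h N : ℕ) (m : ℝ) (i : ℕ) : Set (Finset (ℤ × ℤ)) :=
  {ω | (∃ C, IsCluster ω (Finset.Ico a (a + i * h)) C ∧
      ∀ k : ℕ, k + 2 ≤ i → m ≤ (C ∩ hblock a h k).card) ∧
    (∃ D, IsCluster ω (Finset.Ico (a + (i + 2) * h) (a + N * h)) D ∧
      ∀ k : ℕ, i + 2 ≤ k → k + 2 ≤ N → m ≤ (D ∩ hblock a h k).card) ∧
    ∀ C D, IsCluster ω (Finset.Ico a (a + i * h)) C →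
      (∀ k : ℕ, k + 2 ≤ i → m ≤ (C ∩ hblock a h k).card) →
      IsCluster ω (Finset.Ico (a + (i + 2) * h) (a + N * h)) D →
      (∀ k : ℕ, i + 2 ≤ k → k + 2 ≤ N → m ≤ (D ∩ hblock a h k).card) →
      Disjoint ω (C ×ˢ D)}

/-- Without two disjoint bad blocks, all blocks disjoint from a given bad block i are good and chain
up on each side of it. If i is near an end, the longer chain alone has m sites; otherwise the two
chains must be disconnected, as their union would be large enough. -/
theorem two_bad_or_split {a : ℤ} {h N M : ℕ} {θ m : ℝ} (hh : 0 < h) (hM : 1 ≤ M)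
    (hθ : 7 / 8 ≤ θ) (hN : 2 * M + 4 ≤ N) (hm : m ≤ (N - 2 * M - 4) * (θ * h))
    {ω : Finset (ℤ × ℤ)} (hbad : ¬ Good ω (Finset.Ico a (a + N * h)) m) :
    (∃ i j : ℕ, i + 2 ≤ j ∧ j + 2 ≤ N ∧ ¬ Good ω (hblock a h i) (θ * (2 * h)) ∧
      ¬ Good ω (hblock a h j) (θ * (2 * h))) ∨
    ∃ i : ℕ, 2 * M ≤ i ∧ i + 2 + 2 * M ≤ N ∧ ω ∈ splitEvent a h N (θ * (2 * h)) i := by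
  by_contra hcon
  push Not at hcon
  obtain ⟨hone, hsplit⟩ := hcon
  have hh' : (0 : ℤ) < h := by exact_mod_cast hh
  have hθ0 : 0 ≤ θ := by linarith
  have hθh : 0 ≤ θ * h := by positivity
  -- chains of good blocks
  have hchain : ∀ s n : ℕ, s + n + 2 ≤ N →
      (∀ k : ℕ, s ≤ k → k ≤ s + n → Good ω (hblock a h k) (θ * (2 * h))) →
      ∃ C, IsCluster ω (Finset.Ico (a + s * h) (a + (s + n + 2) * h)) C ∧
        (∀ k : ℕ, s ≤ k → k ≤ s + n → θ * (2 * h) ≤ (C ∩ hblock a h k).card) := by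
    intro s n _ hg
    obtain ⟨C, hC, hc⟩ := exists_isCluster_chain (a := a) hh hθ (ω := ω) s n fun i hi => by
      have := hg (s + i) (by omega) (by omega)
      rwa [Nat.cast_add] at this
    refine ⟨C, hC, fun k hk hk' => ?_⟩
    have := hc (k - s) (by omega)
    rwa [show (s : ℤ) + (k - s : ℕ) = k by omega] at this
  have hcard : ∀ s n : ℕ, ∀ C : Finset ℤ,
      (∀ k : ℕ, s ≤ k → k ≤ s + n → θ * (2 * h) ≤ (C ∩ hblock a h k).card) →
      (n + 1) * (θ * h) ≤ C.card := fun s n C hC =>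
    le_card_of_chain hθ0 (a := a) (s : ℤ) n fun i hi => by
      have := hC (s + i) (by omega) (by omega)
      rwa [Nat.cast_add] at this
  -- A chain of n + 1 blocks has at least (n + 1)θh sites, and n + 1 ≥ N - 2M - 4 contradicts
  -- badness.
  have hbig : ∀ s n : ℕ, s + n + 2 ≤ N → N ≤ n + 2 * M + 5 →
      ¬ ∀ k : ℕ, s ≤ k → k ≤ s + n → Good ω (hblock a h k) (θ * (2 * h)) := by
    intro s n hsn hn hg
    obtain ⟨C, hC, hc⟩ := hchain s n hsn hg
    have hs : (0 : ℤ) ≤ s := by positivity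
    have hsn' : (s : ℤ) + n + 2 ≤ N := by exact_mod_cast hsn
    refine hbad ⟨C, ⟨hC.1.trans (Finset.Ico_subset_Ico (by nlinarith) (by nlinarith)),
      fun x hx y hy => (hC.2 x hx y hy).mono (Finset.inter_subset_inter_left (edgesIn_mono
        (Finset.Ico_subset_Ico (by nlinarith) (by nlinarith))))⟩,
      hm.trans (le_trans (mul_le_mul_of_nonneg_right ?_ hθh) (hcard s n C hc))⟩
    have : (N : ℝ) ≤ n + 2 * M + 5 := by exact_mod_cast hn
    linarith
  obtain ⟨i, hiN, hi⟩ : ∃ i : ℕ, i + 2 ≤ N ∧ ¬ Good ω (hblock a h i) (θ * (2 * h)) := by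
    by_contra hall
    push Not at hall
    exact hbig 0 (N - 2) (by omega) (by omega) fun k _ hk => hall k (by omega)
  have hright : ∀ k : ℕ, i + 2 ≤ k → k + 2 ≤ N → Good ω (hblock a h k) (θ * (2 * h)) :=
    fun k hk hkN => hone i k hk hkN hi
  have hleft : ∀ k : ℕ, k + 2 ≤ i → Good ω (hblock a h k) (θ * (2 * h)) :=
    fun k hk => by
      by_contra hbadk
      exact hi (hone k i hk hiN hbadk)
  rcases Nat.lt_or_ge i (2 * M) with hiM | hiM
  · exact hbig (i + 2) (N - 4 - i) (by omega) (by omega) fun k hk hk' =>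
      hright k hk (by omega)
  rcases Nat.lt_or_ge N (i + 2 + 2 * M) with hiM' | hiM'
  · exact hbig 0 (i - 2) (by omega) (by omega) fun k _ hk => hleft k (by omega)
  refine hsplit i hiM hiM' ⟨?_, ?_, ?_⟩
  · obtain ⟨C, hC, hc⟩ := hchain 0 (i - 2) (by omega) fun k _ hk => hleft k (by omega)
    refine ⟨C, ?_, fun k hk => hc k (by omega) (by omega)⟩
    have e : ((0 : ℕ) : ℤ) + (i - 2 : ℕ) + 2 = i := by omega
    rw [e] at hC
    simpa using hC
  · obtain ⟨D, hD, hd⟩ := hchain (i + 2) (N - 4 - i) (by omega) fun k hk hk' =>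
      hright k hk (by omega)
    refine ⟨D, ?_, fun k hk hk' => hd k hk (by omega)⟩
    have e : ((i + 2 : ℕ) : ℤ) + (N - 4 - i : ℕ) + 2 = N := by omega
    rw [e] at hD
    simpa using hD
  · intro C D hC hc hD hd
    rw [Finset.disjoint_left]
    rintro ⟨x, y⟩ hω hxy
    obtain ⟨hx, hy⟩ := Finset.mem_product.1 hxy
    have hi0 : (0 : ℤ) ≤ i := by positivity
    have hiN' : (i : ℤ) + 2 ≤ N := by exact_mod_cast hiN
    have hsubL : Finset.Ico a (a + i * h) ⊆ Finset.Ico a (a + N * h) :=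
      Finset.Ico_subset_Ico le_rfl (by nlinarith)
    have hsubR : Finset.Ico (a + (i + 2) * h) (a + N * h) ⊆ Finset.Ico a (a + N * h) :=
      Finset.Ico_subset_Ico (by nlinarith) le_rfl
    have hltCD : ∀ x ∈ C, ∀ y ∈ D, x < y := fun x hx y hy => by
      have h1 := (Finset.mem_Ico.1 (hC.1 hx)).2
      have h2 := (Finset.mem_Ico.1 (hD.1 hy)).1
      nlinarith
    have hdisj : Disjoint C D := Finset.disjoint_left.2 fun z hz hz' =>
      lt_irrefl _ (hltCD z hz z hz')
    refine hbad ⟨C ∪ D, hC.union hD hsubL hsubR hx hy (Relation.EqvGen.rel _ _ ?_), ?_⟩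
    · exact Finset.mem_inter.2 ⟨hω, mem_edgesIn.2
        ⟨hsubL (hC.1 hx), hsubR (hD.1 hy), hltCD x hx y hy⟩⟩
    · have h1 := hcard 0 (i - 2) C fun k _ hk => hc k (by omega)
      have h2 := hcard (i + 2) (N - 4 - i) D fun k hk hk' => hd k hk (by omega)
      rw [Finset.card_union_of_disjoint hdisj]
      push_cast
      have e1 : ((i - 2 : ℕ) : ℝ) = i - 2 := by rw [Nat.cast_sub (by omega)]; simp
      have e2 : ((N - 4 - i : ℕ) : ℝ) = N - 4 - i := by
        rw [Nat.cast_sub (by omega), Nat.cast_sub (by omega)]; simp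
      rw [e1] at h1
      rw [e2] at h2
      have hM' : (1 : ℝ) ≤ M := by exact_mod_cast hM
      nlinarith

/-- The margin 2M on each side leaves room for M disjoint dense blocks, which is what
`prod_closed_le` needs. -/
theorem prob_splitEvent_le {b : ℝ} (hb : 0 ≤ b) {a : ℤ} {h N M : ℕ} {m : ℝ} (hh : 0 < h)
    (hm : h ≤ m) {i : ℕ} (hi : 2 * M ≤ i) (hiN : i + 2 + 2 * M ≤ N) :
    prob (edgesIn (Finset.Ico a (a + N * h))) (bondProb b) (splitEvent a h N m i) ≤
      ((M : ℝ) + 1) ^ (-(b / 36)) := by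
  have hh' : (0 : ℤ) < h := by exact_mod_cast hh
  have hi0 : (0 : ℤ) ≤ i := by positivity
  have hiN' : (i : ℤ) + 2 ≤ N := by omega
  refine prob_split_le (bondProb_nonneg hb) (bondProb_le_one b)
    (Finset.Ico_subset_Ico le_rfl (by nlinarith)) (Finset.Ico_subset_Ico (by nlinarith) le_rfl)
    (fun x hx y hy => ?_) _ _ (by positivity) fun C _ D _ hC hD =>
      prod_closed_le hb (i := i) (a := a) hh (fun u hu => ?_) fun v hv => ?_
  · have h1 := (Finset.mem_Ico.1 hx).2
    have h2 := (Finset.mem_Ico.1 hy).1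
    nlinarith
  · have := hC (i - 2 - 2 * u) (by omega)
    rw [show ((i - 2 - 2 * u : ℕ) : ℤ) = i - 2 - 2 * u by omega] at this
    exact hm.trans this
  · have := hD (i + 2 + 2 * v) (by omega) (by omega)
    rw [show ((i + 2 + 2 * v : ℕ) : ℤ) = i + 2 + 2 * v by omega] at this
    exact hm.trans this

/-- Every block of length `2 h` has a cluster of density `θ`, except with probability `ε`. -/
def FailBound (b : ℝ) (h : ℕ) (θ ε : ℝ) : Prop :=
  ∀ a : ℤ, prob (edgesIn (Finset.Ico a (a + 2 * h))) (bondProb b)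
    {ω | ¬ Good ω (Finset.Ico a (a + 2 * h)) (θ * (2 * h))} ≤ ε

/-- Union bound over the alternatives of `two_bad_or_split`: at most (2R)² pairs of disjoint, hence
independent, bad blocks and at most 2R places for a split. -/
theorem FailBound.step {b : ℝ} (hb : 0 ≤ b) {h R M : ℕ} {θ θ' ε : ℝ} (hh : 0 < h) (hM : 1 ≤ M)
    (hθ : 7 / 8 ≤ θ) (hR : M + 2 ≤ R) (hθ' : θ' * (2 * R) ≤ (2 * R - 2 * M - 4) * θ)
    (H : FailBound b h θ ε) :
    FailBound b (R * h) θ' (4 * R ^ 2 * ε ^ 2 + 2 * R * ((M : ℝ) + 1) ^ (-(b / 36))) := by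
  intro a
  have hp0 := bondProb_nonneg hb
  have hp1 := bondProb_le_one b
  have hh0 : (0 : ℝ) < h := by exact_mod_cast hh
  have hh' : (0 : ℤ) < h := by exact_mod_cast hh
  have hq0 : 0 ≤ ((M : ℝ) + 1) ^ (-(b / 36)) := by positivity
  have hV : Finset.Ico a (a + 2 * ((R * h : ℕ) : ℤ)) =
      Finset.Ico a (a + ((2 * R : ℕ) : ℤ) * h) := by
    push_cast; rw [mul_assoc]
  rw [hV]
  set N := 2 * R with hN
  have hNR : (N : ℝ) = 2 * R := by rw [hN]; push_cast; ring
  set V := Finset.Ico a (a + (N : ℤ) * h) with hVdef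
  have hblk : ∀ k : ℕ, hblock a h k = Finset.Ico (a + k * h) (a + k * h + 2 * h) := fun k => by
    rw [hblock]; congr 1; ring
  have hbadk : ∀ k : ℕ, prob (edgesIn (hblock a h k)) (bondProb b)
      {ω | ¬ Good ω (hblock a h k) (θ * (2 * h))} ≤ ε := fun k => by
    rw [hblk]; exact H _
  have hsub : ∀ k : ℕ, k + 2 ≤ N → edgesIn (hblock a h k) ⊆ edgesIn V := fun k hk => by
    have hk' : (k : ℤ) + 2 ≤ N := by exact_mod_cast hk
    have hk0 : (0 : ℤ) ≤ k := by positivity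
    exact edgesIn_mono (Finset.Ico_subset_Ico (by nlinarith) (by nlinarith))
  set I := (Finset.range N ×ˢ Finset.range N).filter fun ij => ij.1 + 2 ≤ ij.2 ∧ ij.2 + 2 ≤ N
  set J := (Finset.range N).filter fun i => 2 * M ≤ i ∧ i + 2 + 2 * M ≤ N
  have hcover := prob_le_sum_add_sum (S := edgesIn V) hp0 hp1
    (A := {ω | ¬ Good ω V (θ' * (2 * (R * h : ℕ)))}) I
    (fun ij => {ω | ¬ Good ω (hblock a h ij.1) (θ * (2 * h))} ∩
      {ω | ¬ Good ω (hblock a h ij.2) (θ * (2 * h))}) J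
    (fun i => splitEvent a h N (θ * (2 * h)) i) fun ω hω => by
      rcases two_bad_or_split hh hM hθ (show 2 * M + 4 ≤ N by omega) (by
        push_cast
        rw [hNR]
        calc θ' * (2 * (R * h)) = θ' * (2 * R) * h := by ring
          _ ≤ (2 * R - 2 * M - 4) * θ * h := mul_le_mul_of_nonneg_right hθ' hh0.le
          _ = _ := by ring) hω with ⟨i, j, hij, hj, hgi, hgj⟩ | ⟨i, hi, hi', hsp⟩
      · refine Or.inl ⟨(i, j), Finset.mem_filter.2 ⟨Finset.mem_product.2 ⟨?_, ?_⟩, hij, hj⟩,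
          hgi, hgj⟩ <;> rw [Finset.mem_range] <;> dsimp only <;> omega
      · exact Or.inr ⟨i, Finset.mem_filter.2 ⟨Finset.mem_range.2 (by omega), hi, hi'⟩, hsp⟩
  refine hcover.trans (add_le_add ?_ ?_)
  · have hterm : ∀ ij ∈ I, prob (edgesIn V) (bondProb b)
        ({ω | ¬ Good ω (hblock a h ij.1) (θ * (2 * h))} ∩
          {ω | ¬ Good ω (hblock a h ij.2) (θ * (2 * h))}) ≤ ε ^ 2 := by
      rintro ⟨i, j⟩ hij
      obtain ⟨-, hij, hj⟩ := Finset.mem_filter.1 hij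
      dsimp only at hij hj
      rw [prob_inter_of_disjoint (hsub i (by omega)) (hsub j hj) (disjoint_edgesIn
        (disjoint_hblock a h (by exact_mod_cast hij))) (bondProb b)
        (fun ω => not_congr (good_inter_edgesIn ω _ _))
        (fun ω => not_congr (good_inter_edgesIn ω _ _)), sq]
      exact mul_le_mul (hbadk i) (hbadk j) (prob_nonneg hp0 hp1 _)
        ((prob_nonneg hp0 hp1 _).trans (hbadk i))
    refine (Finset.sum_le_card_nsmul I _ _ hterm).trans ?_
    rw [nsmul_eq_mul]
    refine mul_le_mul_of_nonneg_right ?_ (sq_nonneg ε)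
    have : I.card ≤ N * N := (Finset.card_filter_le _ _).trans (by simp)
    calc (I.card : ℝ) ≤ (N : ℝ) * N := by exact_mod_cast this
      _ = 4 * R ^ 2 := by rw [hNR]; ring
  · have hterm : ∀ i ∈ J, prob (edgesIn V) (bondProb b) (splitEvent a h N (θ * (2 * h)) i) ≤
        ((M : ℝ) + 1) ^ (-(b / 36)) := fun i hi => by
      obtain ⟨-, hi, hi'⟩ := Finset.mem_filter.1 hi
      exact prob_splitEvent_le hb hh (by nlinarith) hi hi'
    refine (Finset.sum_le_card_nsmul J _ _ hterm).trans ?_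
    rw [nsmul_eq_mul]
    refine mul_le_mul_of_nonneg_right ?_ hq0
    have : J.card ≤ N := (Finset.card_filter_le _ _).trans (by simp)
    calc (J.card : ℝ) ≤ (N : ℝ) := by exact_mod_cast this
      _ = _ := hNR

end Renormalization

/-! ### Choice of scales, and large clusters at the origin. -/

section Iteration

theorem failBound_one {b : ℝ} (hb : 0 ≤ b) : FailBound b 1 1 (Real.exp (-b)) := by
  intro a
  have hp0 := bondProb_nonneg hb
  have hp1 := bondProb_le_one b
  set V := Finset.Ico a (a + 2 * ((1 : ℕ) : ℤ))
  have ha : a ∈ V := by simp [V]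
  have ha' : a + 1 ∈ V := by simp [V]
  have he : (a, a + 1) ∈ edgesIn V := mem_edgesIn.2 ⟨ha, ha', by simp⟩
  have h1 := prob_closed (Finset.singleton_subset_iff.2 he) (bondProb b)
  have h2 : 1 - bondProb b (a, a + 1) = Real.exp (-b) := by simp [bondProb]
  rw [Finset.prod_singleton, h2] at h1
  rw [← h1]
  refine prob_mono hp0 hp1 fun ω _ hω => ?_
  by_contra hopen
  have hmem : (a, a + 1) ∈ ω := by simpa using hopen
  refine hω ⟨{a} ∪ {a + 1}, IsCluster.union (V := V) (V' := V) (x := a) (y := a + 1) ?_ ?_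
    subset_rfl subset_rfl (by simp) (by simp)
    (Relation.EqvGen.rel _ _ (Finset.mem_inter.2 ⟨hmem, he⟩)), ?_⟩
  · refine ⟨Finset.singleton_subset_iff.2 ha, fun x hx y hy => ?_⟩
    rw [Finset.mem_singleton.1 hx, Finset.mem_singleton.1 hy]
    exact Relation.EqvGen.refl _
  · refine ⟨Finset.singleton_subset_iff.2 ha', fun x hx y hy => ?_⟩
    rw [Finset.mem_singleton.1 hx, Finset.mem_singleton.1 hy]
    exact Relation.EqvGen.refl _
  · rw [Finset.card_union_of_disjoint (by simp)]; norm_num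

/-- With y = 2^(-(n+6)), the step takes M = 1/y, R = 1/y² and ε = y⁶. The density loss, of order M/R
= y, is summable, so the density stays above 7/8. The value 432 = 36 · 12 makes the splitting term
at most 2y^(-2)y^12, and 4y⁸ + 2y^10 ≤ (y/2)⁶. -/
theorem exists_failBound (n : ℕ) : ∃ h : ℕ, n + 1 ≤ h ∧
    FailBound 432 h (7 / 8 + (1 / 2) ^ n / 8) (((1 / 2) ^ (n + 6)) ^ 6) := by
  induction n with
  | zero =>
    refine ⟨1, le_rfl, fun a => ?_⟩
    have h1 := failBound_one (b := 432) (by norm_num) a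
    norm_num at h1 ⊢
    refine h1.trans ?_
    have h2 : Real.exp (-432) = Real.exp (-12) ^ 36 := by
      rw [← Real.exp_nat_mul]; norm_num
    have h3 : Real.exp (-12) ≤ 1 / 2 := by
      rw [Real.exp_neg, inv_le_comm₀ (Real.exp_pos _) (by norm_num)]
      have := Real.add_one_le_exp (12 : ℝ)
      linarith
    rw [h2]
    calc Real.exp (-12) ^ 36 ≤ (1 / 2 : ℝ) ^ 36 := by gcongr
      _ ≤ _ := by norm_num
  | succ n ih =>
    obtain ⟨h, hn, H⟩ := ih
    set y : ℝ := (1 / 2) ^ (n + 6) with hy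
    have hy0 : 0 < y := by positivity
    have hy1 : y ≤ 1 / 64 := by
      calc y ≤ (1 / 2 : ℝ) ^ 6 := pow_le_pow_of_le_one (by norm_num) (by norm_num) (by omega)
        _ = 1 / 64 := by norm_num
    have hM : ((2 ^ (n + 6) : ℕ) : ℝ) = y⁻¹ := by rw [hy]; simp
    have hyn : (1 / 2 : ℝ) ^ n = 64 * y := by rw [hy, pow_add]; ring
    have hM1 : 64 ≤ 2 ^ (n + 6) := by
      calc 64 = 2 ^ 6 := by norm_num
        _ ≤ 2 ^ (n + 6) := Nat.pow_le_pow_right (by norm_num) (by omega)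
    have hRM : 4 ^ (n + 6) = 2 ^ (n + 6) * 2 ^ (n + 6) := by
      rw [← mul_pow]; norm_num
    have hR : ((4 ^ (n + 6) : ℕ) : ℝ) = y⁻¹ ^ 2 := by
      rw [← hM, hRM]; push_cast; ring
    have hstep := H.step (by norm_num) (R := 4 ^ (n + 6)) (M := 2 ^ (n + 6))
      (θ' := 7 / 8 + (1 / 2) ^ (n + 1) / 8) (by omega) (by omega)
      (by have : (0 : ℝ) ≤ (1 / 2) ^ n := by positivity
          linarith) (by rw [hRM]; nlinarith) (by
        rw [pow_succ (1 / 2 : ℝ), hyn, hM, hR]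
        have : (2 * y⁻¹ ^ 2 - 2 * y⁻¹ - 4) * (7 / 8 + 64 * y / 8) -
            (7 / 8 + 64 * y * (1 / 2) / 8) * (2 * y⁻¹ ^ 2) =
            (25 / 4 * y⁻¹ - 39 / 2 - 32 * y) := by field_simp; ring
        have h64 : 64 ≤ y⁻¹ := by
          rw [le_inv_comm₀ (by norm_num) hy0]; linarith
        linarith)
    refine ⟨4 ^ (n + 6) * h, ?_, fun a => (hstep a).trans ?_⟩
    · have : 2 ≤ 4 ^ (n + 6) := by rw [hRM]; nlinarith
      calc n + 1 + 1 ≤ 2 * h := by omega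
        _ ≤ 4 ^ (n + 6) * h := Nat.mul_le_mul_right h this
    · rw [show n + 1 + 6 = n + 6 + 1 by omega, pow_succ (1 / 2 : ℝ), ← hy, hM, hR]
      have hp : (y⁻¹ + 1) ^ (-(432 / 36) : ℝ) ≤ y ^ 12 := by
        rw [show (-(432 / 36) : ℝ) = -((12 : ℕ) : ℝ) by norm_num, Real.rpow_neg (by positivity),
          Real.rpow_natCast]
        calc ((y⁻¹ + 1) ^ 12)⁻¹ ≤ (y⁻¹ ^ 12)⁻¹ := by gcongr; linarith
          _ = y ^ 12 := by rw [inv_pow, inv_inv]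
      calc 4 * (y⁻¹ ^ 2) ^ 2 * (y ^ 6) ^ 2 + 2 * y⁻¹ ^ 2 * (y⁻¹ + 1) ^ (-(432 / 36) : ℝ)
          ≤ 4 * (y⁻¹ ^ 2) ^ 2 * (y ^ 6) ^ 2 + 2 * y⁻¹ ^ 2 * y ^ 12 := by gcongr
        _ = y ^ 6 * (4 * y ^ 2 + 2 * y ^ 4) := by field_simp
        _ ≤ y ^ 6 * (1 / 64) := by
          gcongr
          have h2 : y ^ 2 ≤ (1 / 64) ^ 2 := by gcongr
          have h4 : y ^ 4 ≤ (1 / 64) ^ 4 := by gcongr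
          norm_num at h2 h4
          linarith
        _ = (y * (1 / 2)) ^ 6 := by ring

/-- Translation of the edges by `x`. -/
def shiftEdge (x : ℤ) : ℤ × ℤ ↪ ℤ × ℤ where
  toFun e := (e.1 + x, e.2 + x)
  inj' e e' h := by
    simp only [Prod.mk.injEq, add_left_inj] at h
    exact Prod.ext h.1 h.2

theorem shiftEdge_apply (x : ℤ) (e : ℤ × ℤ) : shiftEdge x e = (e.1 + x, e.2 + x) := rfl

theorem edgesIn_shift (x : ℤ) (V : Finset ℤ) :
    edgesIn (V.map (addRightEmbedding x)) = (edgesIn V).map (shiftEdge x) := by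
  ext ⟨u, v⟩
  simp only [mem_edgesIn, Finset.mem_map, shiftEdge_apply,
    addRightEmbedding_apply, Prod.mk.injEq, Prod.exists]
  constructor
  · rintro ⟨⟨u', hu, rfl⟩, ⟨v', hv, rfl⟩, huv⟩
    exact ⟨u', v', ⟨hu, hv, by omega⟩, rfl, rfl⟩
  · rintro ⟨u', v', ⟨hu, hv, huv⟩, rfl, rfl⟩
    exact ⟨⟨u', hu, rfl⟩, ⟨v', hv, rfl⟩, by omega⟩

theorem IsCluster.shift {ω : Finset (ℤ × ℤ)} {V C : Finset ℤ} (hC : IsCluster ω V C) (x : ℤ) :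
    IsCluster (ω.map (shiftEdge x)) (V.map (addRightEmbedding x))
      (C.map (addRightEmbedding x)) := by
  have hconn : ∀ {ω' : Finset (ℤ × ℤ)} {u v : ℤ}, Conn ω' u v →
      Conn (ω'.map (shiftEdge x)) (u + x) (v + x) := by
    intro ω' u v huv
    induction huv with
    | rel u v h => exact Relation.EqvGen.rel _ _ (Finset.mem_map_of_mem (shiftEdge x) h)
    | refl u => exact Relation.EqvGen.refl _
    | symm u v _ ih => exact ih.symm _ _
    | trans u v w _ _ ih ih' => exact ih.trans _ _ _ ih'
  refine ⟨Finset.map_subset_map.2 hC.1, fun u hu v hv => ?_⟩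
  obtain ⟨u', hu', rfl⟩ := Finset.mem_map.1 hu
  obtain ⟨v', hv', rfl⟩ := Finset.mem_map.1 hv
  rw [edgesIn_shift, ← Finset.map_inter]
  exact hconn (hC.2 u' hu' v' hv')

/-- The expected number of sites of V in clusters of size at least m is at least m times the
probability of `Good`. Hence some site is in such a cluster with probability at least c, and
translation invariance moves it to the origin. -/
theorem exists_shift_of_mem {V : Finset ℤ} (hV : V.Nonempty) {b m c : ℝ} (hb : 0 ≤ b)
    (hgood : c * V.card ≤ m * prob (edgesIn V) (bondProb b) {ω | Good ω V m}) :
    ∃ U : Finset ℤ, c ≤ prob (edgesIn U) (bondProb b)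
      {ω | ∃ C, IsCluster ω U C ∧ 0 ∈ C ∧ m ≤ C.card} := by
  have hp0 := bondProb_nonneg hb
  have hp1 := bondProb_le_one b
  have hsum : ∑ x ∈ V, c ≤ ∑ x ∈ V, prob (edgesIn V) (bondProb b)
      {ω | ∃ C, IsCluster ω V C ∧ x ∈ C ∧ m ≤ C.card} := by
    rw [Finset.sum_const, nsmul_eq_mul, mul_comm]
    refine hgood.trans ?_
    simp only [prob]
    rw [← perc_sum, ← perc_const_mul]
    refine perc_mono hp0 hp1 fun ω _ => ?_
    have hn : ∀ x ∈ V, 0 ≤ ({ω | ∃ C, IsCluster ω V C ∧ x ∈ C ∧ m ≤ C.card} :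
        Set (Finset (ℤ × ℤ))).indicator (fun _ => (1 : ℝ)) ω := fun x _ =>
      Set.indicator_nonneg (fun _ _ => zero_le_one) _
    by_cases hω : Good ω V m
    · rw [Set.indicator_of_mem (show ω ∈ {ω | Good ω V m} from hω), mul_one]
      obtain ⟨C, hC, hcard⟩ := hω
      refine hcard.trans (le_trans ?_ (Finset.sum_le_sum_of_subset_of_nonneg hC.1
        fun x hx _ => hn x hx))
      rw [← nsmul_one, ← Finset.sum_const]
      refine Finset.sum_le_sum fun x hx => ?_
      rw [Set.indicator_of_mem]
      exact ⟨C, hC, hx, hcard⟩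
    · rw [Set.indicator_of_notMem (show ω ∉ {ω | Good ω V m} from hω), mul_zero]
      exact Finset.sum_nonneg hn
  obtain ⟨x, hx, hcx⟩ := Finset.exists_le_of_sum_le hV hsum
  refine ⟨V.map (addRightEmbedding (-x)), hcx.trans ?_⟩
  rw [edgesIn_shift, prob_map]
  have hpe : (fun e => bondProb b (shiftEdge (-x) e)) = bondProb b := by
    funext e
    simp only [bondProb, shiftEdge_apply]
    rw [show e.2 + -x - (e.1 + -x) = e.2 - e.1 by ring]
  rw [hpe]
  refine prob_mono hp0 hp1 fun ω _ hω => ?_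
  obtain ⟨C, hC, hxC, hcard⟩ := hω
  refine ⟨_, hC.shift (-x), Finset.mem_map.2 ⟨x, hxC, by simp⟩, by rwa [Finset.card_map]⟩

/-- Percolation: arbitrarily large clusters of the origin in suitable finite windows, with
a probability bounded away from `0`. -/
theorem exists_large_cluster (m : ℕ) : ∃ U : Finset ℤ,
    1 / 4 ≤ prob (edgesIn U) (bondProb 432)
      {ω | ∃ C, IsCluster ω U C ∧ 0 ∈ C ∧ m ≤ C.card} := by
  obtain ⟨h, hmh, H⟩ := exists_failBound m
  have hH := H 0
  set θ : ℝ := 7 / 8 + (1 / 2) ^ m / 8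
  have hθ : 7 / 8 ≤ θ := by
    have : (0 : ℝ) ≤ (1 / 2) ^ m := by positivity
    simp only [θ]; linarith
  have hε : ((1 / 2 : ℝ) ^ (m + 6)) ^ 6 ≤ 1 / 2 := by
    rw [← pow_mul]
    calc (1 / 2 : ℝ) ^ ((m + 6) * 6) ≤ (1 / 2) ^ 1 :=
          pow_le_pow_of_le_one (by norm_num) (by norm_num) (by omega)
      _ = 1 / 2 := by norm_num
  set V := Finset.Ico (0 : ℤ) (0 + 2 * h) with hV
  have hcV : V.card = 2 * h := by rw [hV, Int.card_Ico]; omega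
  have hcompl := prob_compl (edgesIn V) (bondProb 432) {ω | Good ω V (θ * (2 * h))}
  have hgood : 1 / 2 ≤ prob (edgesIn V) (bondProb 432) {ω | Good ω V (θ * (2 * h))} := by
    have : prob (edgesIn V) (bondProb 432) {ω | Good ω V (θ * (2 * h))}ᶜ ≤ 1 / 2 := hH.trans hε
    linarith
  have hh : (m : ℝ) + 1 ≤ h := by exact_mod_cast hmh
  have hm0 : (0 : ℝ) ≤ m := by positivity
  obtain ⟨U, hU⟩ := exists_shift_of_mem (V := V) (b := 432) (m := θ * (2 * h)) (c := 1 / 4)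
    ⟨0, by rw [hV, Finset.mem_Ico]; omega⟩ (by norm_num) (by
      rw [hcV]; push_cast
      -- Density at least 7/8 times success probability at least 1/2 exceeds 1/4.
      calc 1 / 4 * (2 * (h : ℝ)) ≤ θ * (2 * h) * (1 / 2) := by nlinarith
        _ ≤ _ := by gcongr)
  refine ⟨U, hU.trans (prob_mono (bondProb_nonneg (by norm_num)) (bondProb_le_one _)
    fun ω _ => ?_)⟩
  rintro ⟨C, hC, h0, hcard⟩
  refine ⟨C, hC, h0, ?_⟩
  have : (m : ℝ) ≤ C.card := le_trans (by nlinarith) hcard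
  exact_mod_cast this

end Iteration

/-! ### Summability of the interactions that meet a finite volume. -/

section Energy

theorem coupling_nonneg (α : ℝ) (r : ℕ) : 0 ≤ coupling α r := by
  rw [coupling]; split_ifs <;> positivity

theorem summable_coupling {α : ℝ} (hα : 1 < α) :
    Summable fun n : ℤ => coupling α n.natAbs := by
  have h : Summable fun n : ℕ => coupling α n := by
    refine Summable.of_nonneg_of_le (fun n => coupling_nonneg α n) (fun n => ?_)
      (Real.summable_nat_rpow.2 (show -α < -1 by linarith))
    rw [coupling]
    split_ifs
    · positivity
    · exact le_rfl
  exact Summable.of_nat_of_neg (by simpa using h) (by simpa using h)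

/-- The coupling of the pair `p`, if it consists of `x < y` and meets `Λ`. -/
def couplingIn (α : ℝ) (Λ : Finset ℤ) (p : ℤ × ℤ) : ℝ :=
  if p.1 < p.2 ∧ (p.1 ∈ Λ ∨ p.2 ∈ Λ) then coupling α (p.1 - p.2).natAbs else 0

theorem couplingIn_nonneg (α : ℝ) (Λ : Finset ℤ) (p : ℤ × ℤ) : 0 ≤ couplingIn α Λ p := by
  rw [couplingIn]; split_ifs
  · exact coupling_nonneg _ _
  · exact le_rfl

theorem summable_couplingIn {α : ℝ} (hα : 1 < α) (Λ : Finset ℤ) :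
    Summable (couplingIn α Λ) := by
  have h1 : ∀ x : ℤ, Summable fun p : ℤ × ℤ =>
      if p.1 = x then coupling α (p.1 - p.2).natAbs else 0 := fun x => by
    have hinj : Function.Injective fun y : ℤ => (x, y) := fun y y' h => (Prod.ext_iff.1 h).2
    refine (hinj.summable_iff fun p hp => ?_).1 ?_
    · rw [if_neg]
      rintro rfl
      exact hp ⟨p.2, rfl⟩
    · have := (summable_coupling hα).comp_injective (i := fun y : ℤ => x - y)
        fun y y' h => by simpa using h
      simpa [Function.comp_def] using this
  have h2 : ∀ x : ℤ, Summable fun p : ℤ × ℤ =>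
      if p.2 = x then coupling α (p.1 - p.2).natAbs else 0 := fun x => by
    have hinj : Function.Injective fun y : ℤ => (y, x) := fun y y' h => (Prod.ext_iff.1 h).1
    refine (hinj.summable_iff fun p hp => ?_).1 ?_
    · rw [if_neg]
      rintro rfl
      exact hp ⟨p.1, rfl⟩
    · have := (summable_coupling hα).comp_injective (i := fun y : ℤ => y - x)
        fun y y' h => by simpa using h
      simpa [Function.comp_def] using this
  refine Summable.of_nonneg_of_le (couplingIn_nonneg α Λ) (fun p => ?_)
    (summable_sum (s := Λ) fun x _ => (h1 x).add (h2 x))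
  have hn : ∀ x ∈ Λ, 0 ≤ (if p.1 = x then coupling α (p.1 - p.2).natAbs else 0) +
      if p.2 = x then coupling α (p.1 - p.2).natAbs else 0 := fun x _ => by
    have := coupling_nonneg α (p.1 - p.2).natAbs
    positivity
  rw [couplingIn]
  split_ifs with h
  · have hc := coupling_nonneg α (p.1 - p.2).natAbs
    rcases h.2 with h | h
    · refine le_trans ?_ (Finset.single_le_sum hn h)
      rw [if_pos rfl]
      split_ifs <;> linarith
    · refine le_trans ?_ (Finset.single_le_sum hn h)
      rw [if_pos rfl]
      split_ifs <;> linarith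
  · exact Finset.sum_nonneg hn

theorem spin_eq_one_or (σ : Config) (x : ℤ) : spin σ x = 1 ∨ spin σ x = -1 := by
  rcases Int.units_eq_one_or (σ x) with h | h <;> simp [spin, h]

theorem spin_mul_self (σ : Config) (x : ℤ) : spin σ x * spin σ x = 1 := by
  rcases spin_eq_one_or σ x with h | h <;> simp [h]

theorem abs_one_sub_spin_mul_le (σ : Config) (x y : ℤ) : |1 - spin σ x * spin σ y| ≤ 2 := by
  rcases spin_eq_one_or σ x with h | h <;> rcases spin_eq_one_or σ y with h' | h' <;>
    rw [h, h'] <;> norm_num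

theorem energyIn_eq (α : ℝ) (Λ : Finset ℤ) (σ : Config) :
    energyIn α Λ σ = ∑' p : ℤ × ℤ, couplingIn α Λ p * (1 - spin σ p.1 * spin σ p.2) := by
  refine tsum_congr fun p => ?_
  rw [couplingIn]
  split_ifs
  · rfl
  · rw [zero_mul]

theorem summable_energyIn {α : ℝ} (hα : 1 < α) (Λ : Finset ℤ) (σ : Config) :
    Summable fun p : ℤ × ℤ => couplingIn α Λ p * (1 - spin σ p.1 * spin σ p.2) := by
  refine Summable.of_norm_bounded ((summable_couplingIn hα Λ).mul_right 2) fun p => ?_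
  rw [Real.norm_eq_abs, abs_mul, abs_of_nonneg (couplingIn_nonneg α Λ p)]
  exact mul_le_mul_of_nonneg_left (abs_one_sub_spin_mul_le σ _ _) (couplingIn_nonneg α Λ p)

end Energy

/-! ### The `+` state: monotonicity in the volume and the magnetization bound. -/

section PlusState

/-- The value of the spin at `x` with `+` boundary condition outside `Λ`. -/
def siteHom (Λ : Finset ℤ) (x : ℤ) : (Λ → ℤˣ) →* ℤˣ where
  toFun τ := glue Λ (fun _ => 1) τ x
  map_one' := by rw [glue]; split_ifs <;> rfl
  map_mul' τ τ' := by
    simp only [glue]; split_ifs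
    · rfl
    · rw [one_mul]

/-- The product of the spins in `A`, with `+` boundary condition outside `Λ`. -/
def spinHom (Λ A : Finset ℤ) : (Λ → ℤˣ) →* ℤˣ := ∏ x ∈ A, siteHom Λ x

/-- The product of the two spins of the pair `p`. -/
def pairHom (Λ : Finset ℤ) (p : ℤ × ℤ) : (Λ → ℤˣ) →* ℤˣ := siteHom Λ p.1 * siteHom Λ p.2

theorem siteHom_apply (Λ : Finset ℤ) (x : ℤ) (τ : Λ → ℤˣ) :
    siteHom Λ x τ = glue Λ (fun _ => 1) τ x := rfl

theorem siteHom_of_notMem {Λ : Finset ℤ} {x : ℤ} (hx : x ∉ Λ) (τ : Λ → ℤˣ) :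
    siteHom Λ x τ = 1 := by
  rw [siteHom_apply, glue, dif_neg hx]

theorem chr_siteHom (Λ : Finset ℤ) (x : ℤ) (τ : Λ → ℤˣ) :
    chr (siteHom Λ x) τ = spin (glue Λ (fun _ => 1) τ) x := rfl

theorem chr_spinHom (Λ A : Finset ℤ) (τ : Λ → ℤˣ) :
    chr (spinHom Λ A) τ = ∏ x ∈ A, spin (glue Λ (fun _ => 1) τ) x := by
  rw [chr, spinHom, MonoidHom.finsetProd_apply]
  push_cast
  rfl

theorem chr_pairHom (Λ : Finset ℤ) (p : ℤ × ℤ) (τ : Λ → ℤˣ) :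
    chr (pairHom Λ p) τ =
      spin (glue Λ (fun _ => 1) τ) p.1 * spin (glue Λ (fun _ => 1) τ) p.2 := by
  rw [pairHom, chr_mul, chr_siteHom, chr_siteHom]

/-- The Gibbs weights in `Λ` with `+` boundary condition. -/
def plusWeight (α β : ℝ) (Λ : Finset ℤ) (τ : Λ → ℤˣ) : ℝ :=
  Real.exp (-β * energy α (glue Λ (fun _ => 1) τ))

theorem plusWeight_eq (α β : ℝ) (Λ : Finset ℤ) (τ : Λ → ℤˣ) :
    plusWeight α β Λ τ =
      Real.exp (-∑' p, β * couplingIn α Λ p * (1 - chr (pairHom Λ p) τ)) := by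
  rw [plusWeight, ← energyIn_glue_const, energyIn_eq, neg_mul, ← tsum_mul_left]
  simp only [chr_pairHom, mul_assoc]

theorem summable_plusWeight {α : ℝ} (hα : 1 < α) (β : ℝ) (Λ : Finset ℤ) (τ : Λ → ℤˣ) :
    Summable fun p => β * couplingIn α Λ p * (1 - chr (pairHom Λ p) τ) := by
  simp only [chr_pairHom, mul_assoc]
  exact (summable_energyIn hα Λ _).mul_left β

theorem ferro_plusWeight {α β : ℝ} (hα : 1 < α) (hβ : 0 ≤ β) (Λ : Finset ℤ) :
    Ferro (plusWeight α β Λ) := by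
  have := ferro_exp_tsum (fun p => β * couplingIn α Λ p)
    (fun p => mul_nonneg hβ (couplingIn_nonneg α Λ p)) (pairHom Λ) (summable_plusWeight hα β Λ)
  convert this using 1
  funext τ
  exact plusWeight_eq α β Λ τ

/-- The restriction to a larger volume of a configuration that is `+` outside `Λ`. -/
def extendPlus (Λ Λ' : Finset ℤ) (τ : Λ → ℤˣ) : Λ' → ℤˣ := fun x => glue Λ (fun _ => 1) τ x

theorem glue_extendPlus {Λ Λ' : Finset ℤ} (h : Λ ⊆ Λ') (τ : Λ → ℤˣ) :
    glue Λ' (fun _ => 1) (extendPlus Λ Λ' τ) = glue Λ (fun _ => 1) τ := by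
  funext x
  by_cases hx : x ∈ Λ'
  · rw [glue, dif_pos hx]; rfl
  · rw [glue, dif_neg hx, glue, dif_neg fun h' => hx (h h')]

theorem extendPlus_injective {Λ Λ' : Finset ℤ} (h : Λ ⊆ Λ') :
    Function.Injective (extendPlus Λ Λ') := by
  intro τ τ' heq
  funext x
  have := congrFun heq ⟨x, h x.2⟩
  simpa [extendPlus, glue] using this

/-- Correlations with `+` boundary condition decrease when the volume grows. -/
theorem avg_plusWeight_antitone {α β : ℝ} (hα : 1 < α) (hβ : 0 ≤ β) {Λ Λ' : Finset ℤ}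
    (h : Λ ⊆ Λ') (A : Finset ℤ) :
    avg (plusWeight α β Λ') (chr (spinHom Λ' A)) ≤
      avg (plusWeight α β Λ) (chr (spinHom Λ A)) := by
  -- Each factor 1 + σ_y raises correlations and vanishes unless σ_y = +1. Inserting it at every
  -- site of Λ' \ Λ turns the volume Λ' into Λ, up to the constant 2^|Λ' \ Λ|.
  have hstep : ∀ T : Finset ℤ,
      Ferro (fun τ => plusWeight α β Λ' τ * ∏ y ∈ T, (1 + chr (siteHom Λ' y) τ)) ∧
      avg (plusWeight α β Λ') (chr (spinHom Λ' A)) ≤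
      avg (fun τ => plusWeight α β Λ' τ * ∏ y ∈ T, (1 + chr (siteHom Λ' y) τ))
        (chr (spinHom Λ' A)) := by
    intro T
    induction T using Finset.induction_on with
    | empty => simpa using ferro_plusWeight hα hβ Λ'
    | insert y T hy ih =>
      have e : (fun τ => plusWeight α β Λ' τ *
          ∏ y ∈ insert y T, (1 + chr (siteHom Λ' y) τ)) = fun τ =>
          (plusWeight α β Λ' τ * ∏ y ∈ T, (1 + chr (siteHom Λ' y) τ)) *
            (1 + 1 * chr (siteHom Λ' y) τ) := by
        funext τ
        rw [Finset.prod_insert hy]; ring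
      rw [e]
      exact ⟨ih.1.mul_affine _ zero_lt_one zero_le_one le_rfl,
        ih.2.trans (ih.1.avg_le_avg_affine _ _ zero_le_one)⟩
  refine (hstep (Λ' \ Λ)).2.trans (le_of_eq ?_)
  set c : ℝ := 2 ^ (Λ' \ Λ).card
  have hc : c ≠ 0 := by positivity
  have key : ∀ f : Config → ℝ,
      ∑ τ, f (glue Λ (fun _ => 1) τ) * plusWeight α β Λ τ * c =
      ∑ τ, f (glue Λ' (fun _ => 1) τ) *
        (plusWeight α β Λ' τ * ∏ y ∈ Λ' \ Λ, (1 + chr (siteHom Λ' y) τ)) := by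
    intro f
    refine Fintype.sum_of_injective _ (extendPlus_injective h) _ _ (fun τ hτ => ?_) fun τ => ?_
    · have hex : ∃ y ∈ Λ' \ Λ, siteHom Λ' y τ ≠ 1 := by
        by_contra hall
        push Not at hall
        refine hτ ⟨fun x => τ ⟨x, h x.2⟩, ?_⟩
        funext x
        by_cases hx : (x : ℤ) ∈ Λ
        · simp [extendPlus, glue, hx]
        · have := hall x (Finset.mem_sdiff.2 ⟨x.2, hx⟩)
          rw [siteHom_apply, glue, dif_pos x.2] at this
          simp [extendPlus, glue, hx, this]
      obtain ⟨y, hy, hne⟩ := hex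
      have : chr (siteHom Λ' y) τ = -1 := by
        rcases Int.units_eq_one_or (siteHom Λ' y τ) with h | h
        · exact absurd h hne
        · simp [chr, h]
      rw [Finset.prod_eq_zero hy (by rw [this]; norm_num)]; simp
    · rw [plusWeight, plusWeight, glue_extendPlus h, mul_assoc]
      congr 2
      rw [Finset.prod_congr rfl (g := fun _ => (2 : ℝ)), Finset.prod_const]
      intro y hy
      rw [chr_siteHom, glue_extendPlus h, spin, glue, dif_neg (Finset.mem_sdiff.1 hy).2]
      norm_num
  have k1 := key fun σ => ∏ x ∈ A, spin σ x
  have k2 := key fun _ => 1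
  simp only [one_mul] at k2
  rw [avg, avg]
  simp only [chr_spinHom]
  rw [← k1, ← k2, ← Finset.sum_mul, ← Finset.sum_mul, mul_div_mul_right _ _ hc]

/-- The only use of α ≤ 2: r^(-α) ≥ r^(-2) for r ≥ 1. -/
theorem bondProb_le {α β : ℝ} (hα2 : α ≤ 2) (hβ : 432 ≤ β) {e : ℤ × ℤ} (he : e.1 < e.2) :
    bondProb 432 e ≤ 1 - Real.exp (-(β * coupling α (e.1 - e.2).natAbs)) := by
  rw [bondProb, sub_le_sub_iff_left, Real.exp_le_exp, neg_le_neg_iff]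
  have hr : (e.1 - e.2).natAbs ≠ 0 := by omega
  have hr1 : (1 : ℝ) ≤ ((e.1 - e.2).natAbs : ℝ) := by
    exact_mod_cast Nat.one_le_iff_ne_zero.2 hr
  have hcast : ((e.2 - e.1 : ℤ) : ℝ) = ((e.1 - e.2).natAbs : ℝ) := by
    have : (e.2 - e.1 : ℤ) = ((e.1 - e.2).natAbs : ℤ) := by omega
    rw [this]; simp
  rw [coupling, if_neg hr, hcast, div_eq_mul_inv]
  refine mul_le_mul hβ ?_ (by positivity) (by linarith)
  calc (((e.1 - e.2).natAbs : ℝ) ^ 2)⁻¹ = ((e.1 - e.2).natAbs : ℝ) ^ (-2 : ℝ) := by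
        rw [Real.rpow_neg (by linarith)]; norm_num
    _ ≤ _ := Real.rpow_le_rpow_of_exponent_le hr1 (by linarith)

/-- The magnetization at the origin with `+` boundary condition is bounded below, uniformly in
the volume. -/
theorem le_avg_plusWeight {α β : ℝ} (hα1 : 1 < α) (hα2 : α ≤ 2) (hβ : 432 ≤ β)
    (Λ : Finset ℤ) : 1 / 4 ≤ avg (plusWeight α β Λ) (chr (siteHom Λ 0)) := by
  have hβ0 : 0 ≤ β := by linarith
  -- A cluster with more than |Λ| sites contains a site outside Λ. The window U depends on Λ, but
  -- the bound 1/4 does not.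
  obtain ⟨U, hU⟩ := exists_large_cluster (Λ.card + 1)
  -- The interactions of pairs outside the window form the base weight; only those within U are
  -- compared with percolation.
  have hrest := ferro_exp_tsum
    (fun p => if p ∈ edgesIn U then 0 else β * couplingIn α Λ p)
    (fun p => by
      have := mul_nonneg hβ0 (couplingIn_nonneg α Λ p)
      positivity) (pairHom Λ) (fun τ => by
      refine ((summable_plusWeight hα1 β Λ τ).indicator ((edgesIn U : Set (ℤ × ℤ))ᶜ)).congr
        fun p => ?_
      by_cases hp : p ∈ edgesIn U <;> simp [hp])
  have hcmp := hrest.prob_le_avg_exp_sum (edgesIn U) (pairHom Λ)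
    (fun p => β * coupling α (p.1 - p.2).natAbs) (bondProb 432) (bondProb_nonneg (by norm_num))
    (fun e he => bondProb_le hα2 hβ (mem_edgesIn.1 he).2.2) (bondProb_le_one _) (siteHom Λ 0)
  refine hU.trans (le_trans (prob_mono (bondProb_nonneg (by norm_num)) (bondProb_le_one _) ?_)
    (hcmp.trans (le_of_eq ?_)))
  · rintro ω - ⟨C, hC, h0, hcard⟩ τ hτ
    have hconn : ∀ {x y : ℤ}, Conn (ω ∩ edgesIn U) x y →
        siteHom Λ x τ = siteHom Λ y τ := by
      intro x y hxy
      induction hxy with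
      | rel x y h =>
        have := hτ _ (Finset.mem_inter.1 h).1
        rw [pairHom, MonoidHom.mul_apply] at this
        rcases Int.units_eq_one_or (siteHom Λ x τ) with h1 | h1 <;>
          rcases Int.units_eq_one_or (siteHom Λ y τ) with h2 | h2 <;>
          simp_all
      | refl => rfl
      | symm x y _ ih => exact ih.symm
      | trans x y z _ _ ih ih' => exact ih.trans ih'
    obtain ⟨y, hy, hyΛ⟩ : ∃ y ∈ C, y ∉ Λ := by
      by_contra hall
      push Not at hall
      have := Finset.card_le_card (show C ⊆ Λ from hall)
      omega
    rw [hconn (hC.2 0 h0 y hy), siteHom_of_notMem hyΛ]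
  · congr 1
    funext τ
    rw [plusWeight_eq, ← Real.exp_add, ← neg_add]
    congr 2
    -- Pairs of U that miss Λ carry two `+` spins and cost no energy, so including them is harmless.
    have h1 : ∑ e ∈ edgesIn U, β * coupling α (e.1 - e.2).natAbs * (1 - chr (pairHom Λ e) τ) =
        ∑ e ∈ edgesIn U, β * couplingIn α Λ e * (1 - chr (pairHom Λ e) τ) := by
      refine Finset.sum_congr rfl fun e he => ?_
      by_cases hm : e.1 ∈ Λ ∨ e.2 ∈ Λ
      · rw [couplingIn, if_pos ⟨(mem_edgesIn.1 he).2.2, hm⟩]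
      · push Not at hm
        have : chr (pairHom Λ e) τ = 1 := by
          rw [chr, pairHom, MonoidHom.mul_apply, siteHom_of_notMem hm.1, siteHom_of_notMem hm.2]
          simp
        rw [this]; simp
    rw [h1, add_comm, ← (summable_plusWeight hα1 β Λ τ).sum_add_tsum_compl (s := edgesIn U)]
    congr 1
    rw [← tsum_subtype_eq_of_support_subset (s := ((edgesIn U : Set (ℤ × ℤ))ᶜ)) fun p hp => by
      by_contra hmem
      rw [Set.notMem_compl_iff, Finset.mem_coe] at hmem
      simp [hmem] at hp]
    exact tsum_congr fun p => by
      rw [if_neg fun h => p.2 (Finset.mem_coe.2 h)]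

end PlusState

/-! ### Convergence of correlations and weak limits. -/

section Limits

theorem integral_gibbsIn (E : Config → ℝ) (β : ℝ) (Λ : Finset ℤ) (η : Config) (f : Config → ℝ) :
    ∫ σ, f σ ∂gibbsIn E β Λ η =
      avg (fun τ : Λ → ℤˣ => Real.exp (-β * E (glue Λ η τ))) fun τ => f (glue Λ η τ) := by
  rw [gibbsIn, integral_finsetSum_measure fun τ _ =>
    (integrable_dirac (by simp)).smul_measure ENNReal.ofReal_ne_top, avg, Finset.sum_div]
  refine Finset.sum_congr rfl fun τ _ => ?_
  rw [integral_smul_measure, integral_dirac, ENNReal.toReal_ofReal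
    (div_pos (Real.exp_pos _) (partitionFn_pos E β Λ η)).le, smul_eq_mul, partitionFn]
  ring

theorem integral_boxMeasure_one (α β : ℝ) (L : ℕ) (f : Config → ℝ) :
    ∫ σ, f σ ∂(boxMeasure 1 α β L : Measure Config) =
      avg (plusWeight α β (Finset.Icc (-(L : ℤ)) L)) fun τ => f (glue _ (fun _ => 1) τ) :=
  integral_gibbsIn _ _ _ _ f

theorem continuous_spin (x : ℤ) : Continuous fun σ : Config => spin σ x :=
  (continuous_of_discreteTopology (f := fun u : ℤˣ => ((u : ℤ) : ℝ))).comp (continuous_apply x)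

/-- The spin at `x` as a continuous function. -/
def spinMap (x : ℤ) : C(Config, ℝ) := ⟨fun σ => spin σ x, continuous_spin x⟩

/-- The product of the spins in `A` as a continuous function. -/
def spinProd (A : Finset ℤ) : C(Config, ℝ) := ∏ x ∈ A, spinMap x

theorem spinProd_apply (A : Finset ℤ) (σ : Config) : spinProd A σ = ∏ x ∈ A, spin σ x := by
  rw [spinProd, ContinuousMap.coe_prod, Finset.prod_apply]
  rfl

theorem spinMap_mul_spinProd (x : ℤ) (A : Finset ℤ) :
    ∃ B, spinMap x * spinProd A = spinProd B := by
  by_cases hx : x ∈ A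
  · refine ⟨A.erase x, ?_⟩
    rw [spinProd, ← Finset.mul_prod_erase A _ hx, ← mul_assoc]
    have : spinMap x * spinMap x = 1 := by
      ext σ; exact spin_mul_self σ x
    rw [this, one_mul, spinProd]
  · exact ⟨insert x A, by rw [spinProd, spinProd, Finset.prod_insert hx]⟩

/-- Stone–Weierstrass: the spins separate configurations of a compact space. -/
theorem adjoin_spinMap_topologicalClosure :
    (Algebra.adjoin ℝ (Set.range spinMap)).topologicalClosure = ⊤ := by
  refine ContinuousMap.subalgebra_topologicalClosure_eq_top_of_separatesPoints _ ?_
  intro σ σ' hne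
  obtain ⟨x, hx⟩ := Function.ne_iff.1 hne
  refine ⟨spinMap x, ⟨spinMap x, Algebra.subset_adjoin ⟨x, rfl⟩, rfl⟩, fun h => hx ?_⟩
  have h' : ((σ x : ℤ) : ℝ) = ((σ' x : ℤ) : ℝ) := h
  exact Units.ext (by exact_mod_cast h')

theorem integrable_continuousMap (μ : Measure Config) [IsFiniteMeasure μ] (f : C(Config, ℝ)) :
    Integrable f μ :=
  f.continuous.integrable_of_hasCompactSupport (HasCompactSupport.of_compactSpace f)

theorem continuous_integral_continuousMap (μ : Measure Config) [IsProbabilityMeasure μ] :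
    Continuous fun f : C(Config, ℝ) => ∫ σ, f σ ∂μ := by
  refine LipschitzWith.continuous (K := 1) (LipschitzWith.of_dist_le_mul fun f g => ?_)
  rw [dist_eq_norm, ← integral_sub (integrable_continuousMap μ f) (integrable_continuousMap μ g),
    NNReal.coe_one, one_mul]
  refine (norm_integral_le_of_norm_le_const (C := dist f g)
    (Eventually.of_forall fun σ => ?_)).trans (by simp)
  rw [← dist_eq_norm]
  exact ContinuousMap.dist_apply_le_dist σ

/-- Measures on configurations are determined by the correlations. -/
theorem eq_of_integral_spinProd_eq {μ ν : ProbabilityMeasure Config}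
    (h : ∀ A, ∫ σ, spinProd A σ ∂(μ : Measure Config) = ∫ σ, spinProd A σ ∂(ν : Measure Config)) :
    μ = ν := by
  have hclosure : ∀ f ∈ Submonoid.closure (Set.range spinMap), ∃ A, f = spinProd A := by
    intro f hf
    induction hf using Submonoid.closure_induction_left with
    | one => exact ⟨∅, by simp [spinProd]⟩
    | mul_left f hf g _ ih =>
      obtain ⟨x, rfl⟩ := hf
      obtain ⟨A, rfl⟩ := ih
      exact spinMap_mul_spinProd x A
  have hadj : ∀ f ∈ Algebra.adjoin ℝ (Set.range spinMap),
      ∫ σ, f σ ∂(μ : Measure Config) = ∫ σ, f σ ∂(ν : Measure Config) := by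
    intro f hf
    rw [← Subalgebra.mem_toSubmodule, Algebra.adjoin_eq_span] at hf
    induction hf using Submodule.span_induction with
    | mem f hf =>
      obtain ⟨A, rfl⟩ := hclosure f hf
      exact h A
    | zero => simp
    | add f g _ _ ihf ihg =>
      simp only [ContinuousMap.add_apply]
      rw [integral_add (integrable_continuousMap _ f) (integrable_continuousMap _ g),
        integral_add (integrable_continuousMap _ f) (integrable_continuousMap _ g), ihf, ihg]
    | smul c f _ ih =>
      simp only [ContinuousMap.smul_apply, smul_eq_mul]
      rw [integral_const_mul, integral_const_mul, ih]
  have hall : ∀ f : C(Config, ℝ),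
      ∫ σ, f σ ∂(μ : Measure Config) = ∫ σ, f σ ∂(ν : Measure Config) := by
    intro f
    have hf : f ∈ closure (Algebra.adjoin ℝ (Set.range spinMap) : Set C(Config, ℝ)) := by
      rw [← Subalgebra.topologicalClosure_coe, adjoin_spinMap_topologicalClosure]
      trivial
    exact closure_minimal hadj (isClosed_eq (continuous_integral_continuousMap _)
      (continuous_integral_continuousMap _)) hf
  have hμν : (μ : Measure Config) = ν :=
    ext_of_forall_integral_eq_of_IsFiniteMeasure fun f => hall f.toContinuousMap
  exact Subtype.ext hμν

/-- The space of probability measures on `Config` is compact, and all cluster points have the same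
correlations, hence coincide. -/
theorem exists_tendsto_of_integral_spinProd {μ : ℕ → ProbabilityMeasure Config}
    (h : ∀ A, ∃ c, Tendsto (fun L => ∫ σ, spinProd A σ ∂(μ L : Measure Config)) atTop (𝓝 c)) :
    ∃ ν, Tendsto μ atTop (𝓝 ν) := by
  choose c hc using h
  have hcl : ∀ ν, MapClusterPt ν atTop μ → ∀ A, ∫ σ, spinProd A σ ∂(ν : Measure Config) = c A := by
    intro ν hν A
    have h1 := hν.continuousAt_comp
      (ProbabilityMeasure.continuous_integral_continuousMap (spinProd A)).continuousAt
    have h2 : ClusterPt _ (𝓝 (c A)) := ClusterPt.mono h1 (hc A)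
    exact eq_of_nhds_neBot h2
  obtain ⟨ν, hν⟩ := exists_clusterPt_of_compactSpace (map μ atTop)
  refine ⟨ν, tendsto_nhds_of_unique_mapClusterPt fun ν' hν' => ?_⟩
  exact eq_of_integral_spinProd_eq fun A => (hcl ν' hν' A).trans (hcl ν hν A).symm

/-- Correlations decrease with the box and are nonnegative, so each of them converges. -/
theorem exists_tendsto_boxMeasure_one {α β : ℝ} (hα : 1 < α) (hβ : 0 ≤ β) :
    ∃ μ, Tendsto (fun L => boxMeasure 1 α β L) atTop (𝓝 μ) := by
  refine exists_tendsto_of_integral_spinProd fun A => ?_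
  have e : ∀ L : ℕ, ∫ σ, spinProd A σ ∂(boxMeasure 1 α β L : Measure Config) =
      avg (plusWeight α β (Finset.Icc (-(L : ℤ)) L)) (chr (spinHom _ A)) := fun L => by
    rw [integral_boxMeasure_one]
    congr 1
    funext τ
    rw [spinProd_apply, chr_spinHom]
  simp only [e]
  refine ⟨_, tendsto_atTop_ciInf (fun L L' hL => avg_plusWeight_antitone hα hβ
    (Finset.Icc_subset_Icc (by simpa using hL) (by simpa using hL)) A) ⟨0, ?_⟩⟩
  rintro _ ⟨L, rfl⟩
  exact (ferro_plusWeight hα hβ _).avg_nonneg _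

end Limits

/-! ### The `-` state as the image of the `+` state under the global flip. -/

section SpinFlip

/-- The global spin flip. -/
def flip (σ : Config) : Config := fun x => -σ x

theorem spin_flip (σ : Config) (x : ℤ) : spin (flip σ) x = -spin σ x := by
  simp [spin, flip]

theorem continuous_flip : Continuous flip :=
  continuous_pi fun x => (continuous_of_discreteTopology (f := fun u : ℤˣ => -u)).comp
    (continuous_apply x)

theorem energy_flip (α : ℝ) (σ : Config) : energy α (flip σ) = energy α σ := by
  simp only [energy, pairEnergy, spin_flip, neg_mul_neg]

theorem flip_glue (Λ : Finset ℤ) (η : Config) (τ : Λ → ℤˣ) :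
    flip (glue Λ η τ) = glue Λ (flip η) fun x => -τ x := by
  funext x
  rw [flip, glue, glue]
  split_ifs <;> rfl

theorem integral_boxMeasure_neg_one (α β : ℝ) (L : ℕ) (f : Config → ℝ) :
    ∫ σ, f σ ∂(boxMeasure (-1) α β L : Measure Config) =
      ∫ σ, f (flip σ) ∂(boxMeasure 1 α β L : Measure Config) := by
  have h : ∀ F : Config → ℝ, ∑ τ, F (flip (glue (Finset.Icc (-(L : ℤ)) L) (fun _ => 1) τ)) =
      ∑ τ, F (glue (Finset.Icc (-(L : ℤ)) L) (fun _ => -1) τ) := fun F =>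
    Fintype.sum_equiv (Equiv.piCongrRight fun _ => Equiv.neg ℤˣ) _ _ fun τ => by
      rw [flip_glue]; rfl
  have h1 := h fun σ => f σ * Real.exp (-β * energy α σ)
  have h2 := h fun σ => Real.exp (-β * energy α σ)
  simp only [energy_flip] at h1 h2
  refine (integral_gibbsIn _ _ _ _ f).trans ?_
  rw [integral_boxMeasure_one, avg, avg, ← h1, ← h2]
  rfl

theorem tendsto_boxMeasure_neg_one {α β : ℝ} {μ : ProbabilityMeasure Config}
    (h : Tendsto (fun L => boxMeasure 1 α β L) atTop (𝓝 μ)) :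
    Tendsto (fun L => boxMeasure (-1) α β L) atTop
      (𝓝 (μ.map continuous_flip.measurable.aemeasurable)) := by
  have h' := ProbabilityMeasure.tendsto_map_of_tendsto_of_continuous _ _ h continuous_flip
  rw [ProbabilityMeasure.tendsto_iff_forall_integral_tendsto] at h' ⊢
  intro f
  refine (h' f).congr fun L => ?_
  rw [integral_boxMeasure_neg_one, ProbabilityMeasure.toMeasure_map,
    integral_map continuous_flip.measurable.aemeasurable
      f.continuous.measurable.aestronglyMeasurable]

end SpinFlip

/-! ### DLR equations for weak limits. -/

section DLR

theorem glue_glue (Λ : Finset ℤ) (η : Config) (τ ρ : Λ → ℤˣ) :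
    glue Λ (glue Λ η τ) ρ = glue Λ η ρ := by
  funext x
  by_cases hx : x ∈ Λ <;> simp [glue, hx]

/-- The energy outside `Λ` does not depend on the spins in `Λ`. -/
theorem energyIn_sub_energyIn {α : ℝ} (hα : 1 < α) {Λ Δ : Finset ℤ} (h : Λ ⊆ Δ)
    {σ σ' : Config} (hσ : ∀ x ∉ Λ, σ x = σ' x) :
    energyIn α Δ σ - energyIn α Λ σ = energyIn α Δ σ' - energyIn α Λ σ' := by
  have hs := fun Λ σ => summable_energyIn hα Λ σ
  rw [energyIn_eq, energyIn_eq, energyIn_eq, energyIn_eq, ← (hs Δ σ).tsum_sub (hs Λ σ),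
    ← (hs Δ σ').tsum_sub (hs Λ σ')]
  refine tsum_congr fun p => ?_
  by_cases hp : p.1 ∈ Λ ∨ p.2 ∈ Λ
  · have hp' : p.1 ∈ Δ ∨ p.2 ∈ Δ := hp.imp (@h _) (@h _)
    have : couplingIn α Δ p = couplingIn α Λ p := by simp only [couplingIn, hp, hp']
    rw [this]; ring
  · push Not at hp
    have h1 : spin σ p.1 = spin σ' p.1 := by rw [spin, spin, hσ _ hp.1]
    have h2 : spin σ p.2 = spin σ' p.2 := by rw [spin, spin, hσ _ hp.2]
    rw [h1, h2]

/-- Exchange of the spins in `Λ` between a configuration in `Δ` and one in `Λ`. -/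
def exchange {Λ Δ : Finset ℤ} (h : Λ ⊆ Δ) :
    (Δ → ℤˣ) × (Λ → ℤˣ) ≃ (Δ → ℤˣ) × (Λ → ℤˣ) :=
  Function.Involutive.toPerm
    (fun q => (fun x => if hx : (x : ℤ) ∈ Λ then q.2 ⟨x, hx⟩ else q.1 x,
      fun x => q.1 ⟨x, h x.2⟩)) fun q => by
    refine Prod.ext ?_ ?_
    · funext x
      by_cases hx : (x : ℤ) ∈ Λ <;> simp [hx]
    · funext x
      simp

theorem exchange_fst {Λ Δ : Finset ℤ} (h : Λ ⊆ Δ) (q : (Δ → ℤˣ) × (Λ → ℤˣ)) (x : Δ) :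
    (exchange h q).1 x = if hx : (x : ℤ) ∈ Λ then q.2 ⟨x, hx⟩ else q.1 x := rfl

theorem glue_exchange {Λ Δ : Finset ℤ} (h : Λ ⊆ Δ) (η : Config)
    (q : (Δ → ℤˣ) × (Λ → ℤˣ)) :
    glue Δ η (exchange h q).1 = glue Λ (glue Δ η q.1) q.2 := by
  funext x
  by_cases hx : x ∈ Λ
  · simp [glue, exchange_fst, hx, h hx]
  · by_cases hx' : x ∈ Δ <;> simp [glue, exchange_fst, hx, hx']

theorem glue_glue_exchange {Λ Δ : Finset ℤ} (h : Λ ⊆ Δ) (η : Config)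
    (q : (Δ → ℤˣ) × (Λ → ℤˣ)) :
    glue Λ (glue Δ η (exchange h q).1) (exchange h q).2 = glue Δ η q.1 := by
  have := glue_exchange h η (exchange h q)
  rwa [show exchange h (exchange h q) = q from (exchange h).left_inv q, eq_comm] at this

/-- Finite-volume Gibbs measures are invariant under resampling in a smaller volume. -/
theorem integral_integral_gibbsIn {α : ℝ} (hα : 1 < α) (β : ℝ) {Λ Δ : Finset ℤ} (h : Λ ⊆ Δ)
    (s : ℤˣ) (f : Config → ℝ) :
    ∫ η, ∫ σ, f σ ∂gibbsIn (energyIn α Λ) β Λ η ∂gibbsIn (energy α) β Δ (fun _ => s) =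
      ∫ σ, f σ ∂gibbsIn (energy α) β Δ (fun _ => s) := by
  rw [integral_gibbsIn, integral_gibbsIn]
  simp only [integral_gibbsIn, ← energyIn_glue_const, avg]
  congr 1
  set σ : (Δ → ℤˣ) → Config := fun τ => glue Δ (fun _ => s) τ
  set w : Config → ℝ := fun η => Real.exp (-β * energyIn α Δ η)
  set v : Config → ℝ := fun η => Real.exp (-β * energyIn α Λ η)
  set Z : Config → ℝ := fun η => ∑ ρ : Λ → ℤˣ, v (glue Λ η ρ)
  have hZ : ∀ η, Z η ≠ 0 := fun η =>
    (Finset.sum_pos (fun _ _ => Real.exp_pos _) Finset.univ_nonempty).ne'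
  have hoff : ∀ (η : Config) (ρ : Λ → ℤˣ), ∀ x ∉ Λ, glue Λ η ρ x = η x := fun η ρ x hx => by
    simp [glue, hx]
  -- Detailed balance: w/v involves only pairs that miss Λ, so it is unchanged by resampling in Λ.
  have hbal : ∀ (η : Config) (ρ : Λ → ℤˣ), w (glue Λ η ρ) * v η = w η * v (glue Λ η ρ) := by
    intro η ρ
    have := energyIn_sub_energyIn hα h (hoff η ρ)
    simp only [w, v]
    rw [← Real.exp_add, ← Real.exp_add]
    congr 1
    linear_combination (-β) * this
  calc ∑ τ, (∑ ρ : Λ → ℤˣ, f (glue Λ (σ τ) ρ) * v (glue Λ (σ τ) ρ)) / Z (σ τ) * w (σ τ)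
      = ∑ q : (Δ → ℤˣ) × (Λ → ℤˣ),
          f (glue Λ (σ q.1) q.2) * v (glue Λ (σ q.1) q.2) / Z (σ q.1) * w (σ q.1) := by
        rw [Fintype.sum_prod_type]
        refine Finset.sum_congr rfl fun τ _ => ?_
        rw [Finset.sum_div, Finset.sum_mul]
    _ = ∑ q : (Δ → ℤˣ) × (Λ → ℤˣ),
          f (σ q.1) * w (σ q.1) * (v (glue Λ (σ q.1) q.2) / Z (σ q.1)) := by
        -- Exchanging old and new spins in Λ puts f at the original configuration; Z does not see
        -- the spins in Λ, and detailed balance moves the weights back.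
        rw [← (exchange h).sum_comp]
        refine Finset.sum_congr rfl fun q _ => ?_
        simp only [σ]
        rw [glue_glue_exchange, glue_exchange]
        have hZ' : Z (glue Λ (glue Δ (fun _ => s) q.1) q.2) = Z (glue Δ (fun _ => s) q.1) := by
          simp only [Z, glue_glue]
        rw [hZ']
        have := hbal (glue Δ (fun _ => s) q.1) q.2
        have hZ0 := hZ (glue Δ (fun _ => s) q.1)
        field_simp
        linear_combination f (glue Δ (fun _ => s) q.1) * this
    _ = ∑ τ, f (σ τ) * w (σ τ) := by
        rw [Fintype.sum_prod_type]
        refine Finset.sum_congr rfl fun τ _ => ?_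
        simp only
        rw [← Finset.mul_sum, ← Finset.sum_div, div_self (hZ (σ τ)), mul_one]

theorem continuous_glue (Λ : Finset ℤ) (τ : Λ → ℤˣ) : Continuous fun η => glue Λ η τ := by
  refine continuous_pi fun x => ?_
  by_cases hx : x ∈ Λ
  · simpa [glue, hx] using continuous_const
  · simpa [glue, hx] using continuous_apply x

/-- Weierstrass M-test, using the summability given by α > 1. This makes the resampling kernel
preserve continuous functions. -/
theorem continuous_energyIn {α : ℝ} (hα : 1 < α) (Λ : Finset ℤ) :
    Continuous (energyIn α Λ) := by
  have : energyIn α Λ = fun σ => ∑' p : ℤ × ℤ,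
      couplingIn α Λ p * (1 - spin σ p.1 * spin σ p.2) := funext (energyIn_eq α Λ)
  rw [this]
  refine continuous_tsum (fun p => ?_) ((summable_couplingIn hα Λ).mul_right 2) fun p σ => ?_
  · exact continuous_const.mul
      (continuous_const.sub ((continuous_spin _).mul (continuous_spin _)))
  · rw [Real.norm_eq_abs, abs_mul, abs_of_nonneg (couplingIn_nonneg α Λ p)]
    exact mul_le_mul_of_nonneg_left (abs_one_sub_spin_mul_le σ _ _) (couplingIn_nonneg α Λ p)

theorem continuous_gibbsWeight {α : ℝ} (hα : 1 < α) (β : ℝ) (Λ : Finset ℤ) (τ : Λ → ℤˣ) :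
    Continuous fun η => Real.exp (-β * energyIn α Λ (glue Λ η τ)) :=
  Real.continuous_exp.comp
    (continuous_const.mul ((continuous_energyIn hα Λ).comp (continuous_glue Λ τ)))

theorem continuous_partitionFn {α : ℝ} (hα : 1 < α) (β : ℝ) (Λ : Finset ℤ) :
    Continuous (partitionFn (energyIn α Λ) β Λ) :=
  continuous_finsetSum _ fun τ _ => continuous_gibbsWeight hα β Λ τ

theorem continuous_integral_gibbsIn {α : ℝ} (hα : 1 < α) (β : ℝ) (Λ : Finset ℤ)
    (f : C(Config, ℝ)) : Continuous fun η => ∫ σ, f σ ∂gibbsIn (energyIn α Λ) β Λ η := by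
  simp only [integral_gibbsIn]
  exact Continuous.div (continuous_finsetSum _ fun τ _ =>
    (f.continuous.comp (continuous_glue Λ τ)).mul (continuous_gibbsWeight hα β Λ τ))
    (continuous_partitionFn hα β Λ) fun η => (partitionFn_pos _ β Λ η).ne'

theorem measurable_gibbsIn {α : ℝ} (hα : 1 < α) (β : ℝ) (Λ : Finset ℤ) :
    Measurable (gibbsIn (energyIn α Λ) β Λ) := by
  refine Measure.measurable_of_measurable_coe _ fun A hA => ?_
  simp only [gibbsIn, Measure.coe_finsetSum, Finset.sum_apply, Measure.smul_apply, smul_eq_mul,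
    Measure.dirac_apply' _ hA]
  refine Finset.measurable_fun_sum _ fun τ _ => Measurable.mul ?_ ?_
  · exact ((continuous_gibbsWeight hα β Λ τ).measurable.div
      (continuous_partitionFn hα β Λ).measurable).ennreal_ofReal
  · exact (measurable_one.indicator hA).comp (continuous_glue Λ τ).measurable

/-- Weak limits of finite-volume Gibbs measures with constant boundary condition are
infinite-volume Gibbs measures. -/
theorem isGibbsMeasure_of_tendsto {α : ℝ} (hα : 1 < α) {β : ℝ} {s : ℤˣ}
    {μ : ProbabilityMeasure Config}
    (hμ : Tendsto (fun L => boxMeasure s α β L) atTop (𝓝 μ)) : IsGibbsMeasure α β μ := by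
  intro Λ A hA
  have hmeas := measurable_gibbsIn hα β Λ
  -- Both sides are integrals of continuous functions, so the finite-volume identity, valid once the
  -- box contains Λ, passes to the weak limit.
  have hcont : ∀ f : C(Config, ℝ),
      ∫ η, ∫ σ, f σ ∂gibbsIn (energyIn α Λ) β Λ η ∂(μ : Measure Config) =
        ∫ σ, f σ ∂(μ : Measure Config) := by
    intro f
    set g : C(Config, ℝ) := ⟨_, continuous_integral_gibbsIn hα β Λ f⟩
    have hg := ((ProbabilityMeasure.continuous_integral_continuousMap g).tendsto μ).comp hμ
    have hf := ((ProbabilityMeasure.continuous_integral_continuousMap f).tendsto μ).comp hμ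
    refine tendsto_nhds_unique (hg.congr' ?_) hf
    have hsub : ∀ᶠ L : ℕ in atTop, Λ ⊆ Finset.Icc (-(L : ℤ)) L := by
      filter_upwards [eventually_ge_atTop (∑ x ∈ Λ, x.natAbs)] with L hL x hx
      have := Finset.single_le_sum (f := fun x : ℤ => x.natAbs) (fun _ _ => Nat.zero_le _) hx
      rw [Finset.mem_Icc]
      omega
    filter_upwards [hsub] with L hL
    exact integral_integral_gibbsIn hα β hL s f
  -- Equality on continuous functions identifies the measures, which gives the DLR equation for all
  -- measurable sets.
  have key : (μ : Measure Config) =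
      (μ : Measure Config).bind (gibbsIn (energyIn α Λ) β Λ) := by
    refine ext_of_forall_lintegral_eq_of_IsFiniteMeasure fun f => ?_
    have hfm : Measurable fun σ => (f σ : ENNReal) :=
      f.continuous.measurable.coe_nnreal_ennreal
    rw [Measure.lintegral_bind hmeas.aemeasurable hfm.aemeasurable]
    set F : C(Config, ℝ) := ⟨fun σ => (f σ : ℝ), NNReal.continuous_coe.comp f.continuous⟩
    have hF : ∀ ν : Measure Config, IsProbabilityMeasure ν →
        ∫⁻ σ, (f σ : ENNReal) ∂ν = ENNReal.ofReal (∫ σ, F σ ∂ν) := by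
      intro ν _
      rw [ofReal_integral_eq_lintegral_ofReal (integrable_continuousMap ν F)
        (Eventually.of_forall fun σ => (f σ).2)]
      refine lintegral_congr fun σ => ?_
      exact (ENNReal.ofReal_coe_nnreal).symm
    have hint : Integrable (fun η => ∫ σ, F σ ∂gibbsIn (energyIn α Λ) β Λ η)
        (μ : Measure Config) :=
      integrable_continuousMap (μ : Measure Config) ⟨_, continuous_integral_gibbsIn hα β Λ F⟩
    rw [hF _ inferInstance, ← hcont F, lintegral_congr fun η => hF (gibbsIn _ β Λ η) inferInstance,
      ofReal_integral_eq_lintegral_ofReal hint (Eventually.of_forall fun η =>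
          integral_nonneg fun σ => (f σ).2)]
  conv_lhs => rw [key]
  exact Measure.bind_apply hA hmeas.aemeasurable

end DLR

end LongRangeIsing

end

/-! ### The phase transition. -/

theorem mainTheorem1 (α : ℝ) (hα1 : 1 < α) (hα2 : α ≤ 2) :
    ∃ βbar : ℝ, 0 < βbar ∧ ∀ β : ℝ, βbar ≤ β →
      ∃ μminus μplus : ProbabilityMeasure LongRangeIsing.Config,
        Tendsto (fun L : ℕ => LongRangeIsing.boxMeasure (-1) α β L) atTop (𝓝 μminus) ∧
        Tendsto (fun L : ℕ => LongRangeIsing.boxMeasure 1 α β L) atTop (𝓝 μplus) ∧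
        LongRangeIsing.IsGibbsMeasure α β μminus ∧
        LongRangeIsing.IsGibbsMeasure α β μplus ∧
        ∫ σ, LongRangeIsing.spin σ 0 ∂(μminus : Measure LongRangeIsing.Config) ≠
          ∫ σ, LongRangeIsing.spin σ 0 ∂(μplus : Measure LongRangeIsing.Config) := by
  refine ⟨432, by norm_num, fun β hβ => ?_⟩
  obtain ⟨μ, hμ⟩ := LongRangeIsing.exists_tendsto_boxMeasure_one hα1 (show 0 ≤ β by linarith)
  have hμ' := LongRangeIsing.tendsto_boxMeasure_neg_one hμ
  refine ⟨_, μ, hμ', hμ, LongRangeIsing.isGibbsMeasure_of_tendsto hα1 hμ',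
    LongRangeIsing.isGibbsMeasure_of_tendsto hα1 hμ, ?_⟩
  have hlim := ((ProbabilityMeasure.continuous_integral_continuousMap
    (LongRangeIsing.spinMap 0)).tendsto μ).comp hμ
  have hpos : 1 / 4 ≤ ∫ σ, LongRangeIsing.spin σ 0 ∂(μ : Measure LongRangeIsing.Config) :=
    ge_of_tendsto' hlim fun L => by
      have := LongRangeIsing.le_avg_plusWeight hα1 hα2 hβ (Finset.Icc (-(L : ℤ)) L)
      exact this.trans_eq (LongRangeIsing.integral_boxMeasure_one α β L
        fun σ => LongRangeIsing.spin σ 0).symm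
  -- The `-` magnetization is the opposite of the `+` one, which is at least 1/4.
  rw [ProbabilityMeasure.toMeasure_map, integral_map
    LongRangeIsing.continuous_flip.measurable.aemeasurable
    (LongRangeIsing.continuous_spin 0).measurable.aestronglyMeasurable]
  simp only [LongRangeIsing.spin_flip, integral_neg]
  linarith
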